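/- Let $n \geq 2$ be an integer and let $s \in \mathbb R$ satisfy $s - \frac n2 \in (0,1)$. Let $\mathbb S^n \subset \mathbb R^{n+1}$ be the unit sphere with its (non-normalized) surface measure, let $P_\ell$ be the $L^2(\mathbb S^n)$-orthogonal projection onto the spherical harmonics of degree $\ell$, and let $$H^s(\mathbb S^n) = \Big\{ u \in L^2(\mathbb S^n) : \sum_{\ell \ge 0} (1 + \ell(\ell+n-1))^s \|P_\ell u\|_2^2 < \infty \Big\},$$ whose elements (real-valued) are identified with their continuous representatives; $u>0$ means $u(\omega)>0$ for all $\omega \in \mathbb S^n$. For $u, v \in H^s(\mathbb S^n)$ set $$a_{2s}[u,v] = \sum_{\ell=0}^\infty \alpha_{2s}(\ell)\, (P_\ell u, P_\ell v)_{L^2}, \qquad a_{2s}[u] = a_{2s}[u,u], \qquad \alpha_{2s}(\ell) = \frac{\Gamma(\ell + \frac n2 + s)}{\Gamma(\ell + \frac n2 - s)},$$ and let $$\mathcal S_s = (4\pi)^s\, \frac{\Gamma(\frac{n+2s}{2})}{\Gamma(\frac{n-2s}{2})} \left( \frac{\Gamma(\frac n2)}{\Gamma(n)} \right)^{2s/n},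 \qquad \|u\|_{\frac{2n}{n-2s}} = \Big( \int_{\mathbb S^n} u^{\frac{2n}{n-2s}} \, d\omega \Big)^{\frac{n-2s}{2n}} \quad (u > 0).$$ Let $\mathcal M$ be the manifold of all functions $\omega \mapsto c\,(1 - \zeta\cdot\omega)^{\frac{2s-n}{2}}$ with $c > 0$, $\zeta \in \mathbb R^{n+1}$, $|\zeta| < 1$. For $h \in \mathcal M$ let $T_h\mathcal M$ be its tangent space at $h$, and let $(T_h\mathcal M)^\perp = \{\rho \in H^s(\mathbb S^n) : a_{2s}[\rho,\varphi] = 0 \text{ for all } \varphi \in T_h \mathcal M\}$. For $0 < u \in H^s(\mathbb S^n) \setminus \mathcal M$ define $$\mathsf d(u) = \inf\big\{ a_{2s}[\rho] : u = h + \rho,\ h \in \mathcal M,\ \rho \in (T_h\mathcal M)^\perp \big\}, \qquad \mathcal E(u) = \frac{a_{2s}[u] - \mathcal S_s \|u\|_{\frac{2n}{n-2s}}^2}{\mathsf d(u)},$$ and $$c_{BE}(s) = \inf_{0 < u \in H^s(\mathbb S^n)\setminus \mathcal M} \mathcal E(u).$$ Then $$c_{BE}(s) < \frac{4s}{n + 2s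 + 2}.$$ -/

import Mathlib

open MeasureTheory Metric

namespace ReverseSobolev

noncomputable section

/-- The unit sphere `𝕊ⁿ ⊂ ℝⁿ⁺¹`. -/
abbrev Sph (n : ℕ) : Type := sphere (0 : EuclideanSpace ℝ (Fin (n + 1))) 1

/-- The (non-normalized) surface measure on `𝕊ⁿ`, with total mass `|𝕊ⁿ|`. -/
abbrev surf (n : ℕ) : Measure (Sph n) :=
  (volume : Measure (EuclideanSpace ℝ (Fin (n + 1)))).toSphere

/-- The Hilbert space `L²(𝕊ⁿ)` of real functions. -/
abbrev L2 (n : ℕ) : Type := Lp ℝ 2 (surf n)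

/-- The class in `L²(𝕊ⁿ)` of a continuous function. -/
def toL2 (n : ℕ) : C(Sph n, ℝ) →L[ℝ] L2 n := ContinuousMap.toLp 2 (surf n) ℝ

/-! ### Spherical harmonics -/

/-- Real polynomials in `n + 1` variables that are homogeneous of degree `ℓ` and harmonic. -/
def solidHarmonics (n ℓ : ℕ) : Submodule ℝ (MvPolynomial (Fin (n + 1)) ℝ) :=
  MvPolynomial.homogeneousSubmodule (Fin (n + 1)) ℝ ℓ ⊓
    LinearMap.ker (∑ i : Fin (n + 1),
      (MvPolynomial.pderiv (R := ℝ) i).toLinearMap ∘ₗ (MvPolynomial.pderiv (R := ℝ) i).toLinearMap)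

theorem mem_solidHarmonics {n ℓ : ℕ} {P : MvPolynomial (Fin (n + 1)) ℝ} :
    P ∈ solidHarmonics n ℓ ↔ P.IsHomogeneous ℓ ∧
      ∑ i : Fin (n + 1), MvPolynomial.pderiv i (MvPolynomial.pderiv i P) = 0 := by
  simp [solidHarmonics, MvPolynomial.mem_homogeneousSubmodule, LinearMap.sum_apply]

/-- Restriction of a polynomial to the sphere. -/
def restrictSphere (n : ℕ) : MvPolynomial (Fin (n + 1)) ℝ →ₗ[ℝ] C(Sph n, ℝ) where
  toFun P := ⟨fun ω => MvPolynomial.eval (fun i => (ω : EuclideanSpace ℝ (Fin (n + 1))) i) P,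
    (MvPolynomial.continuous_eval P).comp (by fun_prop)⟩
  map_add' P Q := by ext ω; simp
  map_smul' a P := by ext ω; simp

/-- The space `E_ℓ ⊂ L²(𝕊ⁿ)` of spherical harmonics of degree `ℓ`. -/
def sphericalHarmonics (n ℓ : ℕ) : Submodule ℝ (L2 n) :=
  (solidHarmonics n ℓ).map ((toL2 n).toLinearMap ∘ₗ restrictSphere n)

instance finiteDimensional_homogeneous (n ℓ : ℕ) :
    FiniteDimensional ℝ (MvPolynomial.homogeneousSubmodule (Fin (n + 1)) ℝ ℓ) :=
  Module.Finite.iff_fg.mpr (MvPolynomial.homogeneousSubmodule_fg _ _ ℓ)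

instance finiteDimensional_sphericalHarmonics (n ℓ : ℕ) :
    FiniteDimensional ℝ (sphericalHarmonics n ℓ) := by
  have : FiniteDimensional ℝ (solidHarmonics n ℓ) :=
    Submodule.finiteDimensional_of_le (S₂ := MvPolynomial.homogeneousSubmodule (Fin (n + 1)) ℝ ℓ)
      inf_le_left
  unfold sphericalHarmonics
  infer_instance

/-- The `L²`-orthogonal projection `P_ℓ` onto the spherical harmonics of degree `ℓ`. -/
def proj (n ℓ : ℕ) : L2 n →L[ℝ] L2 n := (sphericalHarmonics n ℓ).starProjection

/-- `f ∈ Hˢ(𝕊ⁿ)`, in the spectral form: `-Δ` has the eigenvalue `ℓ (ℓ + n - 1)` on the spherical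
harmonics of degree `ℓ`. -/
def MemHs (n : ℕ) (s : ℝ) (f : L2 n) : Prop :=
  Summable fun ℓ : ℕ => (1 + (ℓ : ℝ) * (ℓ + n - 1)) ^ s * ‖proj n ℓ f‖ ^ 2

/-! ### The quadratic form and the optimizers -/

/-- The eigenvalue `α_{2s}(ℓ) = Γ(ℓ + n/2 + s) / Γ(ℓ + n/2 - s)`. -/
def alpha (n : ℕ) (s : ℝ) (ℓ : ℕ) : ℝ :=
  Real.Gamma (ℓ + n / 2 + s) / Real.Gamma (ℓ + n / 2 - s)

/-- The bilinear form `a_{2s}[f, g]`. -/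
def bilin (n : ℕ) (s : ℝ) (f g : L2 n) : ℝ :=
  ∑' ℓ : ℕ, alpha n s ℓ * inner ℝ (proj n ℓ f) (proj n ℓ g)

/-- The quadratic form `a_{2s}[f] = ∑ α_{2s}(ℓ) ‖P_ℓ f‖²`. -/
def quad (n : ℕ) (s : ℝ) (f : L2 n) : ℝ :=
  ∑' ℓ : ℕ, alpha n s ℓ * ‖proj n ℓ f‖ ^ 2

/-- The sharp constant `𝒮_s` of the reverse Sobolev inequality. -/
def sobolevConst (n : ℕ) (s : ℝ) : ℝ :=
  (4 * Real.pi) ^ s * (Real.Gamma ((n + 2 * s) / 2) / Real.Gamma ((n - 2 * s) / 2)) *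
    (Real.Gamma (n / 2) / Real.Gamma n) ^ (2 * s / n)

/-- `‖u‖_q = (∫ u^q)^{1/q}` for positive `u` and real `q ≠ 0`, possibly negative. -/
def powNorm (n : ℕ) (q : ℝ) (u : C(Sph n, ℝ)) : ℝ :=
  (∫ ω, u ω ^ q ∂(surf n)) ^ (1 / q)

/-- The manifold `ℳ` of the functions `ω ↦ c (1 - ζ · ω)^{(2s - n)/2}`, `c > 0`, `|ζ| < 1`. -/
def optimizers (n : ℕ) (s : ℝ) : Set C(Sph n, ℝ) :=
  {h | ∃ (c : ℝ) (ζ : EuclideanSpace ℝ (Fin (n + 1))), 0 < c ∧ ‖ζ‖ < 1 ∧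
    ∀ ω : Sph n, h ω =
      c * (1 - inner ℝ ζ (ω : EuclideanSpace ℝ (Fin (n + 1)))) ^ ((2 * s - n) / 2)}

/-- The tangent space `T_h ℳ`: the velocities at time `0` of the paths in `ℳ` that pass through
`h` at time `0`. -/
def tangentSpace (n : ℕ) (s : ℝ) (h : C(Sph n, ℝ)) : Set C(Sph n, ℝ) :=
  {φ | ∃ (ε : ℝ) (γ : ℝ → C(Sph n, ℝ)), 0 < ε ∧ (∀ t ∈ Set.Ioo (-ε) ε, γ t ∈ optimizers n s) ∧
    γ 0 = h ∧ ∀ ω : Sph n, HasDerivAt (fun t => γ t ω) (φ ω) 0}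

/-- The orthogonal complement `(T_h ℳ)^⊥` in `Hˢ(𝕊ⁿ)` with respect to `a_{2s}`. -/
def tangentPerp (n : ℕ) (s : ℝ) (h : C(Sph n, ℝ)) : Set (L2 n) :=
  {ρ | MemHs n s ρ ∧ ∀ φ ∈ tangentSpace n s h, bilin n s ρ (toL2 n φ) = 0}

/-! ### The stability quotient -/

/-- The modified distance `𝖽(u)`: the infimum of `a_{2s}[ρ]` over all decompositions `u = h + ρ`
with `h ∈ ℳ` and `ρ ∈ (T_h ℳ)^⊥`. -/
def stabDist (n : ℕ) (s : ℝ) (u : C(Sph n, ℝ)) : EReal :=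
  sInf {r : EReal | ∃ h ∈ optimizers n s, ∃ ρ ∈ tangentPerp n s h,
    toL2 n u = toL2 n h + ρ ∧ r = ((quad n s ρ : ℝ) : EReal)}

/-- The stability quotient `ℰ(u)`. -/
def quotient (n : ℕ) (s : ℝ) (u : C(Sph n, ℝ)) : EReal :=
  ((quad n s (toL2 n u) - sobolevConst n s * powNorm n (2 * n / (n - 2 * s)) u ^ 2 : ℝ) : EReal) /
    stabDist n s u

/-- The functions `0 < u ∈ Hˢ(𝕊ⁿ) \ ℳ`. For `s > n/2` every class in `Hˢ(𝕊ⁿ)` has exactly one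
continuous representative, and `u` is that representative. -/
def admissible (n : ℕ) (s : ℝ) : Set C(Sph n, ℝ) :=
  {u | MemHs n s (toL2 n u) ∧ (∀ ω, 0 < u ω) ∧ u ∉ optimizers n s}

/-- The stability constant `c_BE(s)`: the infimum of `ℰ(u)` over `0 < u ∈ Hˢ(𝕊ⁿ) \ ℳ`, taken in
the extended reals. -/
def cBE (n : ℕ) (s : ℝ) : EReal := sInf (quotient n s '' admissible n s)

end

end ReverseSobolev

namespace ReverseSobolev

open Set

/-! Perturb the optimizer 1 by a spherical harmonic φ of degree two: u = 1 - δφ with small δ > 0. By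
`sobolevConst_mul_rpow` the terms of order zero in the deficit cancel, and the δ² term is (α(2) -
α(1)) ∫φ². Since α(2) - α(1) = 4s/(n+2s+2) · α(2), division by δ² α(2) ∫φ² gives exactly the bound
to be beaten. Strictness comes from the δ³ term, which lowers the deficit when ∫φ³ > 0
(`eventually_rpow_integral_lt`, `testFunction_numerator_lt`). The choice φ = ω_iω_j + ω_jω_k +
ω_kω_i has this property (`integral_pairSum_cube_pos`). That sign and the orthogonality of harmonics
are read off from Gaussian integrals.

The denominator needs 𝖽(u) ≥ δ² α(2) ∫φ², the value at h = 1, against every competing decomposition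
u = h + ρ (`le_quad_of_decomposition`). Scaling puts h itself in T_hℳ, so a[h] = a[h,u] and a[ρ] =
a[u] - a[h,u]; the claim becomes a[h,u] ≤ α(0)|𝕊ⁿ|. Only α(0) is negative, so keeping degrees 0 and
1 bounds a[h] from below. With I = ∫(ζ·ω)², the degree-one energy of h is at least a multiple of
c²I, whereas h couples to δφ only at order cδI. For small δ, uniformly in ζ and c, the former wins
(`neg_mul_le_of_projection_bounds`). -/

/-! ### Gaussian moments -/

/-- The `k`-th moment of the weight `exp (-x²)` on the line. -/
noncomputable def gaussMoment (k : ℕ) : ℝ := ∫ x : ℝ, x ^ k * Real.exp (-x ^ 2)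

theorem integrable_pow_mul_exp_neg_sq (k : ℕ) :
    Integrable fun x : ℝ => x ^ k * Real.exp (-x ^ 2) := by
  have h := integrable_rpow_mul_exp_neg_mul_sq (b := 1) one_pos (s := k)
    (by have : (0 : ℝ) ≤ k := k.cast_nonneg
        linarith)
  simpa [Real.rpow_natCast] using h

/-- The derivative of x^k exp(-x²) integrates to zero. For k = 0 the truncated index k - 1 is
harmless because of the factor k. -/
theorem two_mul_gaussMoment_succ (k : ℕ) :
    2 * gaussMoment (k + 1) = k * gaussMoment (k - 1) := by
  have hd : ∀ x : ℝ, HasDerivAt (fun x : ℝ => x ^ k * Real.exp (-x ^ 2))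
      (k * (x ^ (k - 1) * Real.exp (-x ^ 2)) - 2 * (x ^ (k + 1) * Real.exp (-x ^ 2))) x := by
    intro x
    have h := (hasDerivAt_pow k x).mul (((hasDerivAt_pow 2 x).neg).exp)
    refine h.congr_deriv ?_
    simp only [Pi.neg_apply, Nat.cast_ofNat, Nat.add_one_sub_one, pow_one]
    ring
  have h1 := (integrable_pow_mul_exp_neg_sq (k - 1)).const_mul (k : ℝ)
  have h2 := (integrable_pow_mul_exp_neg_sq (k + 1)).const_mul 2
  have h := integral_eq_zero_of_hasDerivAt_of_integrable hd (h1.sub h2)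
    (integrable_pow_mul_exp_neg_sq k)
  rw [integral_sub h1 h2, integral_const_mul, integral_const_mul] at h
  simp only [gaussMoment]
  linarith

theorem gaussMoment_odd (k : ℕ) : gaussMoment (2 * k + 1) = 0 := by
  induction k with
  | zero => simpa using two_mul_gaussMoment_succ 0
  | succ k ih =>
    have h := two_mul_gaussMoment_succ (2 * (k + 1))
    rw [show 2 * (k + 1) - 1 = 2 * k + 1 by omega, ih] at h
    simpa using h

theorem gaussMoment_even_pos (k : ℕ) : 0 < gaussMoment (2 * k) := by
  induction k with
  | zero =>
    have h := integral_gaussian 1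
    simp only [neg_mul, one_mul, div_one] at h
    simp only [gaussMoment, mul_zero, pow_zero, one_mul, h]
    exact Real.sqrt_pos.mpr Real.pi_pos
  | succ k ih =>
    have h := two_mul_gaussMoment_succ (2 * k + 1)
    rw [show 2 * k + 1 - 1 = 2 * k by omega] at h
    have : 0 < ((2 * k + 1 : ℕ) : ℝ) * gaussMoment (2 * k) := by positivity
    rw [show 2 * (k + 1) = 2 * k + 1 + 1 by ring]
    linarith

/-! ### Gaussian integrals of polynomials in several variables -/

variable {ι : Type*} [Fintype ι]

theorem monomial_mul_exp_eq_prod (m : ι →₀ ℕ) (a : ℝ) (x : EuclideanSpace ℝ ι) :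
    MvPolynomial.eval (fun i => x i) (MvPolynomial.monomial m a) * Real.exp (-‖x‖ ^ 2) =
      a * ∏ i, (x i ^ m i * Real.exp (-x i ^ 2)) := by
  rw [MvPolynomial.eval_monomial, Finset.prod_mul_distrib, ← Real.exp_sum,
    EuclideanSpace.real_norm_sq_eq, Finset.sum_neg_distrib,
    Finsupp.prod_fintype _ _ (fun i => pow_zero _), mul_assoc]

theorem integrable_monomial_mul_exp (m : ι →₀ ℕ) (a : ℝ) :
    Integrable fun x : EuclideanSpace ℝ ι =>
      MvPolynomial.eval (fun i => x i) (MvPolynomial.monomial m a) * Real.exp (-‖x‖ ^ 2) := by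
  simp_rw [monomial_mul_exp_eq_prod]
  have h : Integrable fun y : ι → ℝ => ∏ i, (y i ^ m i * Real.exp (-y i ^ 2)) :=
    Integrable.fintype_prod fun i => integrable_pow_mul_exp_neg_sq (m i)
  have e := EuclideanSpace.volume_preserving_symm_measurableEquiv_toLp ι
  exact ((e.integrable_comp_emb (MeasurableEquiv.measurableEmbedding _)).mpr h).const_mul a

theorem integral_monomial_mul_exp (m : ι →₀ ℕ) (a : ℝ) :
    ∫ x : EuclideanSpace ℝ ι,
      MvPolynomial.eval (fun i => x i) (MvPolynomial.monomial m a) * Real.exp (-‖x‖ ^ 2) =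
      a * ∏ i, gaussMoment (m i) := by
  simp_rw [monomial_mul_exp_eq_prod]
  rw [integral_const_mul]
  have e := EuclideanSpace.volume_preserving_symm_measurableEquiv_toLp ι
  have h := e.integral_comp (MeasurableEquiv.measurableEmbedding _)
    (fun y : ι → ℝ => ∏ i, (y i ^ m i * Real.exp (-y i ^ 2)))
  congr 1
  refine Eq.trans h ?_
  exact integral_fintype_prod_volume_eq_prod fun i (t : ℝ) => t ^ m i * Real.exp (-t ^ 2)

theorem integrable_polynomial_mul_exp (P : MvPolynomial ι ℝ) :
    Integrable fun x : EuclideanSpace ℝ ι =>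
      MvPolynomial.eval (fun i => x i) P * Real.exp (-‖x‖ ^ 2) := by
  induction P using MvPolynomial.induction_on' with
  | monomial m a => exact integrable_monomial_mul_exp m a
  | add p q hp hq =>
    simp only [map_add, add_mul]
    exact hp.add hq

/-- Integration of polynomials against the weight `exp (-‖x‖²)`. -/
noncomputable def gaussIntegral (ι : Type*) [Fintype ι] : MvPolynomial ι ℝ →ₗ[ℝ] ℝ where
  toFun P := ∫ x : EuclideanSpace ℝ ι,
    MvPolynomial.eval (fun i => x i) P * Real.exp (-‖x‖ ^ 2)
  map_add' P Q := by
    simp only [map_add, add_mul]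
    exact integral_add (integrable_polynomial_mul_exp P) (integrable_polynomial_mul_exp Q)
  map_smul' a P := by
    simp only [MvPolynomial.smul_eval, mul_assoc, RingHom.id_apply, smul_eq_mul]
    rw [integral_const_mul]

theorem gaussIntegral_monomial (m : ι →₀ ℕ) (a : ℝ) :
    gaussIntegral ι (MvPolynomial.monomial m a) = a * ∏ i, gaussMoment (m i) :=
  integral_monomial_mul_exp m a

/-- Gaussian integration by parts. -/
theorem gaussIntegral_pderiv (i : ι) (P : MvPolynomial ι ℝ) :
    gaussIntegral ι (MvPolynomial.pderiv i P) = 2 * gaussIntegral ι (MvPolynomial.X i * P) := by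
  classical
  -- On a monomial the integral is a product of moments, and the two sides differ only in the i-th
  -- factor, where the one-dimensional recursion applies.
  have key : ∀ (m : ι →₀ ℕ) (a : ℝ),
      gaussIntegral ι (MvPolynomial.pderiv i (MvPolynomial.monomial m a)) =
        2 * gaussIntegral ι (MvPolynomial.X i * MvPolynomial.monomial m a) := by
    intro m a
    rw [MvPolynomial.pderiv_monomial, MvPolynomial.X, MvPolynomial.monomial_mul,
      gaussIntegral_monomial, gaussIntegral_monomial, ← Finset.mul_prod_erase _ _ (Finset.mem_univ i),
      ← Finset.mul_prod_erase Finset.univ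
        (fun j => gaussMoment ((Finsupp.single i 1 + m : ι →₀ ℕ) j)) (Finset.mem_univ i)]
    have hp : ∏ j ∈ Finset.univ.erase i, gaussMoment ((m - Finsupp.single i 1 : ι →₀ ℕ) j) =
        ∏ j ∈ Finset.univ.erase i, gaussMoment ((Finsupp.single i 1 + m : ι →₀ ℕ) j) := by
      refine Finset.prod_congr rfl fun j hj => ?_
      have hij : i ≠ j := (Finset.ne_of_mem_erase hj).symm
      simp [Finsupp.single_eq_of_ne' hij]
    have h := two_mul_gaussMoment_succ (m i)
    rw [hp]
    generalize ∏ j ∈ Finset.univ.erase i, gaussMoment ((Finsupp.single i 1 + m : ι →₀ ℕ) j) = p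
    simp only [Finsupp.coe_tsub, Pi.sub_apply, Finsupp.single_eq_same, Finsupp.coe_add,
      Pi.add_apply, one_mul, add_comm 1 (m i)]
    linear_combination (-a * p) * h
  induction P using MvPolynomial.induction_on' with
  | monomial m a => exact key m a
  | add p q hp hq => rw [map_add, map_add, mul_add, map_add, hp, hq, mul_add]

theorem gaussIntegral_monomial_eq_zero {m : ι →₀ ℕ} {i : ι} (hi : Odd (m i)) (a : ℝ) :
    gaussIntegral ι (MvPolynomial.monomial m a) = 0 := by
  obtain ⟨k, hk⟩ := hi
  rw [gaussIntegral_monomial, Finset.prod_eq_zero (Finset.mem_univ i), mul_zero]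
  rw [hk, gaussMoment_odd]

theorem gaussIntegral_monomial_pos {m : ι →₀ ℕ} (h : ∀ i, Even (m i)) {a : ℝ} (ha : 0 < a) :
    0 < gaussIntegral ι (MvPolynomial.monomial m a) := by
  rw [gaussIntegral_monomial]
  refine mul_pos ha (Finset.prod_pos fun i _ => ?_)
  obtain ⟨k, hk⟩ := h i
  rw [hk, ← two_mul]
  exact gaussMoment_even_pos k

/-- Homogeneous harmonic polynomials of different degrees are orthogonal for the Gaussian weight. -/
theorem gaussIntegral_mul_eq_zero {P Q : MvPolynomial ι ℝ} {k l : ℕ} (hkl : k ≠ l)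
    (hP : P.IsHomogeneous k) (hQ : Q.IsHomogeneous l)
    (hP' : ∑ i, MvPolynomial.pderiv i (MvPolynomial.pderiv i P) = 0)
    (hQ' : ∑ i, MvPolynomial.pderiv i (MvPolynomial.pderiv i Q) = 0) :
    gaussIntegral ι (P * Q) = 0 := by
  -- Euler's identity writes l·Q as ∑ x_i ∂_i Q, and integration by parts then leaves ∫∇P·∇Q since
  -- ΔQ = 0. The result is symmetric in P and Q, so the degrees k and l give the same value.
  have key : ∀ {P Q : MvPolynomial ι ℝ} {l : ℕ}, Q.IsHomogeneous l →
      ∑ i, MvPolynomial.pderiv i (MvPolynomial.pderiv i Q) = 0 →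
      2 * (l * gaussIntegral ι (P * Q)) =
        gaussIntegral ι (∑ i, MvPolynomial.pderiv i P * MvPolynomial.pderiv i Q) := by
    intro P Q l hQ hQ'
    have e : ∀ i, 2 * gaussIntegral ι (MvPolynomial.X i * (P * MvPolynomial.pderiv i Q)) =
        gaussIntegral ι (P * MvPolynomial.pderiv i (MvPolynomial.pderiv i Q)) +
          gaussIntegral ι (MvPolynomial.pderiv i P * MvPolynomial.pderiv i Q) := by
      intro i
      rw [← gaussIntegral_pderiv, Derivation.leibniz, map_add, smul_eq_mul, smul_eq_mul,
        mul_comm (MvPolynomial.pderiv i Q)]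
    have s : ∑ i, MvPolynomial.X i * (P * MvPolynomial.pderiv i Q) = (l : ℝ) • (P * Q) := by
      have := hQ.sum_X_mul_pderiv
      simp_rw [mul_left_comm _ P, ← Finset.mul_sum, this]
      rw [mul_smul_comm, Nat.cast_smul_eq_nsmul]
    have h1 : (l : ℝ) * gaussIntegral ι (P * Q) =
        ∑ i, gaussIntegral ι (MvPolynomial.X i * (P * MvPolynomial.pderiv i Q)) := by
      rw [← map_sum, s, map_smul, smul_eq_mul]
    rw [h1, Finset.mul_sum, Finset.sum_congr rfl fun i _ => e i, Finset.sum_add_distrib,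
      ← map_sum, ← map_sum, ← Finset.mul_sum, hQ', mul_zero, map_zero, zero_add]
  have h1 := key (P := P) hQ hQ'
  have h2 := key (P := Q) hP hP'
  simp_rw [mul_comm (MvPolynomial.pderiv _ Q)] at h2
  rw [← h1, mul_comm Q P] at h2
  have hne : (k : ℝ) - l ≠ 0 := sub_ne_zero.mpr (by exact_mod_cast hkl)
  have : ((k : ℝ) - l) * gaussIntegral ι (P * Q) = 0 := by linarith
  exact (mul_eq_zero.mp this).resolve_left hne

/-! ### From Gaussian integrals to integrals over the sphere -/

/-- Polar coordinates for the integral of a homogeneous function times a radial function. -/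
theorem integral_homogeneous_mul_radial {E : Type*} [NormedAddCommGroup E] [NormedSpace ℝ E]
    [MeasurableSpace E] [BorelSpace E] [FiniteDimensional ℝ E] [Nontrivial E] (μ : Measure E)
    [μ.IsAddHaarMeasure] {d : ℕ} {F : E → ℝ} (hF : ∀ (r : ℝ) (x : E), F (r • x) = r ^ d * F x)
    (g : ℝ → ℝ) :
    ∫ x, F x * g ‖x‖ ∂μ = (∫ ω : sphere (0 : E) 1, F ω ∂μ.toSphere) *
      ∫ r in Ioi (0 : ℝ), r ^ (Module.finrank ℝ E - 1) * (r ^ d * g r) :=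
  calc
    ∫ x, F x * g ‖x‖ ∂μ = ∫ x : ({(0)}ᶜ : Set E), F x.1 * g ‖x.1‖ ∂(μ.comap (↑)) := by
      rw [integral_subtype_comap (measurableSet_singleton _).compl fun x ↦ F x * g ‖x‖,
        restrict_compl_singleton]
    _ = ∫ x, F x.1 * ((x.2 : ℝ) ^ d * g x.2)
        ∂μ.toSphere.prod (.volumeIoiPow (Module.finrank ℝ E - 1)) := by
      rw [← μ.measurePreserving_homeomorphUnitSphereProd.integral_comp
        (Homeomorph.measurableEmbedding _)]
      refine integral_congr_ae (.of_forall fun x => ?_)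
      have hx : F x.1 = ‖x.1‖ ^ d * F (‖x.1‖⁻¹ • x.1) := by
        rw [← hF, smul_smul, mul_inv_cancel₀ (norm_ne_zero_iff.mpr x.2), one_smul]
      simp only [homeomorphUnitSphereProd_apply_snd_coe, homeomorphUnitSphereProd_apply_fst_coe]
      rw [hx]
      ring
    _ = (∫ ω : sphere (0 : E) 1, F ω ∂μ.toSphere) *
        ∫ r : Ioi (0 : ℝ), (r : ℝ) ^ d * g r ∂.volumeIoiPow (Module.finrank ℝ E - 1) :=
      integral_prod_mul (fun ω : sphere (0 : E) 1 => F ω) fun r : Ioi (0 : ℝ) => (r : ℝ) ^ d * g r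
    _ = _ := by
      congr 1
      simp only [Measure.volumeIoiPow, ENNReal.ofReal]
      rw [integral_withDensity_eq_integral_smul,
        integral_subtype_comap measurableSet_Ioi fun a ↦
          Real.toNNReal (a ^ (Module.finrank ℝ E - 1)) • (a ^ d * g a),
        setIntegral_congr_fun measurableSet_Ioi fun x hx ↦ ?_]
      · simp only [NNReal.smul_def]
        rw [Real.coe_toNNReal _ (pow_nonneg hx.out.le _), smul_eq_mul]
      · exact (measurable_subtype_coe.pow_const _).real_toNNReal

/-- In polar coordinates the constant is a radial moment depending on n and d alone. Vanishing and
positivity therefore pass from Gaussian to spherical integrals without computing the latter. -/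
theorem exists_gaussIntegral_eq (n d : ℕ) : ∃ c : ℝ, 0 < c ∧
    ∀ P : MvPolynomial (Fin (n + 1)) ℝ, P.IsHomogeneous d →
      gaussIntegral (Fin (n + 1)) P = c * ∫ ω, restrictSphere n P ω ∂(surf n) := by
  refine ⟨∫ r in Ioi (0 : ℝ), r ^ (Module.finrank ℝ (EuclideanSpace ℝ (Fin (n + 1))) - 1) *
    (r ^ d * Real.exp (-r ^ 2)), ?_, fun P hP => ?_⟩
  · have hi : IntegrableOn (fun r : ℝ => r ^ (n + d) * Real.exp (-r ^ 2)) (Ioi 0) :=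
      (integrable_pow_mul_exp_neg_sq (n + d)).integrableOn
    have : ∀ r : ℝ, r ^ (Module.finrank ℝ (EuclideanSpace ℝ (Fin (n + 1))) - 1) *
        (r ^ d * Real.exp (-r ^ 2)) = r ^ (n + d) * Real.exp (-r ^ 2) := by
      intro r
      simp [pow_add, mul_assoc]
    simp_rw [this]
    refine (setIntegral_pos_iff_support_of_nonneg_ae ?_ hi).mpr ?_
    · filter_upwards [ae_restrict_mem measurableSet_Ioi] with r hr
      have : (0 : ℝ) < r := hr
      simp only [Pi.zero_apply]
      positivity
    · have hsub : Ioi (0 : ℝ) ⊆ Function.support (fun r : ℝ => r ^ (n + d) * Real.exp (-r ^ 2)) := by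
        intro r hr
        have : (0 : ℝ) < r := hr
        exact (by positivity : r ^ (n + d) * Real.exp (-r ^ 2) ≠ 0)
      rw [inter_eq_right.mpr hsub]
      simp
  · rw [mul_comm]
    refine integral_homogeneous_mul_radial volume (d := d)
      (F := fun x : EuclideanSpace ℝ (Fin (n + 1)) => MvPolynomial.eval (fun i => x i) P) ?_
      (fun r => Real.exp (-r ^ 2))
    intro r x
    simp only [MvPolynomial.eval_eq', Finset.mul_sum]
    refine Finset.sum_congr rfl fun m hm => ?_
    have hd : ∑ i, m i = d := by
      have := hP (MvPolynomial.mem_support_iff.mp hm)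
      rw [← this, Finsupp.weight_apply, Finsupp.sum_fintype _ _ (by simp)]
      simp
    simp only [PiLp.smul_apply, smul_eq_mul, mul_pow, Finset.prod_mul_distrib,
      Finset.prod_pow_eq_pow_sum, hd]
    ring

/-! ### Spherical harmonics -/

theorem restrictSphere_apply {n : ℕ} (P : MvPolynomial (Fin (n + 1)) ℝ) (ω : Sph n) :
    restrictSphere n P ω =
      MvPolynomial.eval (fun i => (ω : EuclideanSpace ℝ (Fin (n + 1))) i) P := rfl

theorem integrable_continuousMap {n : ℕ} (f : C(Sph n, ℝ)) : Integrable f (surf n) :=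
  f.continuous.integrable_of_hasCompactSupport (HasCompactSupport.of_compactSpace _)

theorem inner_toL2 {n : ℕ} (f g : C(Sph n, ℝ)) :
    inner ℝ (toL2 n f) (toL2 n g) = ∫ ω, f ω * g ω ∂(surf n) := by
  rw [toL2, ContinuousMap.inner_toLp]
  simp [mul_comm]

theorem norm_toL2_sq {n : ℕ} (f : C(Sph n, ℝ)) :
    ‖toL2 n f‖ ^ 2 = ∫ ω, f ω ^ 2 ∂(surf n) := by
  rw [← real_inner_self_eq_norm_sq, inner_toL2]
  simp_rw [pow_two]

theorem integral_solidHarmonics_mul_eq_zero {n k l : ℕ} (hkl : k ≠ l)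
    {P Q : MvPolynomial (Fin (n + 1)) ℝ} (hP : P ∈ solidHarmonics n k)
    (hQ : Q ∈ solidHarmonics n l) :
    ∫ ω, restrictSphere n P ω * restrictSphere n Q ω ∂(surf n) = 0 := by
  rw [mem_solidHarmonics] at hP hQ
  obtain ⟨c, hc, h⟩ := exists_gaussIntegral_eq n (k + l)
  have h1 := h (P * Q) (hP.1.mul hQ.1)
  rw [gaussIntegral_mul_eq_zero hkl hP.1 hQ.1 hP.2 hQ.2] at h1
  have := (mul_eq_zero.mp h1.symm).resolve_left hc.ne'
  simpa [restrictSphere_apply] using this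

theorem toL2_restrictSphere_mem {n k : ℕ} {P : MvPolynomial (Fin (n + 1)) ℝ}
    (hP : P ∈ solidHarmonics n k) : toL2 n (restrictSphere n P) ∈ sphericalHarmonics n k :=
  Submodule.mem_map.mpr ⟨P, hP, rfl⟩

theorem proj_restrictSphere_self {n k : ℕ} {P : MvPolynomial (Fin (n + 1)) ℝ}
    (hP : P ∈ solidHarmonics n k) :
    proj n k (toL2 n (restrictSphere n P)) = toL2 n (restrictSphere n P) :=
  Submodule.starProjection_eq_self_iff.mpr (toL2_restrictSphere_mem hP)

theorem proj_restrictSphere_of_ne {n k l : ℕ} (hkl : k ≠ l) {P : MvPolynomial (Fin (n + 1)) ℝ}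
    (hP : P ∈ solidHarmonics n k) : proj n l (toL2 n (restrictSphere n P)) = 0 := by
  refine (Submodule.starProjection_apply_eq_zero_iff _).mpr ?_
  rw [Submodule.mem_orthogonal]
  intro v hv
  obtain ⟨Q, hQ, rfl⟩ := Submodule.mem_map.mp hv
  exact (inner_toL2 _ _).trans (integral_solidHarmonics_mul_eq_zero hkl.symm hQ hP)

theorem inner_proj_proj {n l : ℕ} (f g : L2 n) :
    inner ℝ (proj n l f) (proj n l g) = inner ℝ f (proj n l g) := by
  unfold proj
  rw [Submodule.inner_starProjection_left_eq_right]
  congr 1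
  exact Submodule.starProjection_eq_self_iff.mpr (Submodule.starProjection_apply_mem _ _)

theorem one_mem_solidHarmonics (n : ℕ) : (1 : MvPolynomial (Fin (n + 1)) ℝ) ∈ solidHarmonics n 0 := by
  rw [mem_solidHarmonics]
  exact ⟨MvPolynomial.isHomogeneous_one _ _, by simp⟩

/-- The linear form `x ↦ ζ · x` as a polynomial. -/
noncomputable def linearForm {n : ℕ} (ζ : EuclideanSpace ℝ (Fin (n + 1))) :
    MvPolynomial (Fin (n + 1)) ℝ :=
  ∑ i, MvPolynomial.C (ζ i) * MvPolynomial.X i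

theorem linearForm_mem_solidHarmonics {n : ℕ} (ζ : EuclideanSpace ℝ (Fin (n + 1))) :
    linearForm ζ ∈ solidHarmonics n 1 := by
  refine Submodule.sum_mem _ fun i _ => ?_
  rw [mem_solidHarmonics]
  refine ⟨by simpa using (MvPolynomial.isHomogeneous_C _ (ζ i)).mul (MvPolynomial.isHomogeneous_X ℝ i),
    Finset.sum_eq_zero fun j _ => ?_⟩
  rw [MvPolynomial.pderiv_C_mul, MvPolynomial.pderiv_X, MvPolynomial.pderiv_C_mul]
  by_cases h : i = j
  · subst h; simp
  · simp [h]

theorem restrictSphere_linearForm {n : ℕ} (ζ : EuclideanSpace ℝ (Fin (n + 1))) (ω : Sph n) :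
    restrictSphere n (linearForm ζ) ω = inner ℝ ζ (ω : EuclideanSpace ℝ (Fin (n + 1))) := by
  simp [restrictSphere_apply, linearForm, PiLp.inner_apply, mul_comm]

theorem restrictSphere_one {n : ℕ} (ω : Sph n) : restrictSphere n 1 ω = 1 := by
  simp [restrictSphere_apply]

/-- The quadratic polynomial `x_i x_j + x_j x_k + x_k x_i`. -/
noncomputable def pairSum {n : ℕ} (i j k : Fin (n + 1)) : MvPolynomial (Fin (n + 1)) ℝ :=
  MvPolynomial.X i * MvPolynomial.X j + MvPolynomial.X j * MvPolynomial.X k +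
    MvPolynomial.X k * MvPolynomial.X i

theorem X_mul_X_mem_solidHarmonics {n : ℕ} {i j : Fin (n + 1)} (hij : i ≠ j) :
    (MvPolynomial.X i * MvPolynomial.X j : MvPolynomial (Fin (n + 1)) ℝ) ∈ solidHarmonics n 2 := by
  rw [mem_solidHarmonics]
  refine ⟨(MvPolynomial.isHomogeneous_X ℝ i).mul (MvPolynomial.isHomogeneous_X ℝ j),
    Finset.sum_eq_zero fun l _ => ?_⟩
  simp only [Derivation.leibniz, MvPolynomial.pderiv_X, map_add, smul_eq_mul]
  by_cases h1 : i = l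
  · subst h1
    simp [hij.symm]
  · by_cases h2 : j = l
    · subst h2
      simp [hij]
    · simp [h1, h2]

/-! ### The degree-two harmonic with positive cubic integral -/

section pairSum

variable {n : ℕ} {i j k : Fin (n + 1)}

theorem restrictSphere_pairSum (ω : Sph n) :
    restrictSphere n (pairSum i j k) ω = ω.1 i * ω.1 j + ω.1 j * ω.1 k + ω.1 k * ω.1 i := by
  simp [restrictSphere_apply, pairSum]

theorem abs_restrictSphere_pairSum_le (ω : Sph n) : |restrictSphere n (pairSum i j k) ω| ≤ 3 := by
  have h : ∀ l, |ω.1 l| ≤ 1 := fun l => by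
    have := PiLp.norm_apply_le ω.1 l
    rwa [norm_eq_of_mem_sphere ω, Real.norm_eq_abs] at this
  have h2 : ∀ l m, |ω.1 l * ω.1 m| ≤ 1 := fun l m => by
    rw [abs_mul]
    exact mul_le_one₀ (h l) (abs_nonneg _) (h m)
  rw [restrictSphere_pairSum]
  linarith [abs_add_three (ω.1 i * ω.1 j) (ω.1 j * ω.1 k) (ω.1 k * ω.1 i), h2 i j, h2 j k, h2 k i]

theorem pairSum_mem_solidHarmonics (hij : i ≠ j) (hjk : j ≠ k) (hki : k ≠ i) : pairSum i j k ∈ solidHarmonics n 2 :=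
  add_mem (add_mem (X_mul_X_mem_solidHarmonics hij) (X_mul_X_mem_solidHarmonics hjk))
    (X_mul_X_mem_solidHarmonics hki)

/-- In the expansion of the cube, every monomial except 6 x_i²x_j²x_k² contains a third power and so
integrates to zero by parity. -/
theorem integral_pairSum_cube_pos (hij : i ≠ j) (hjk : j ≠ k) (hki : k ≠ i) :
    0 < ∫ ω, restrictSphere n (pairSum i j k) ω ^ 3 ∂(surf n) := by
  obtain ⟨c, hc, h⟩ := exists_gaussIntegral_eq n 6
  have h1 := h (pairSum i j k ^ 3)
    (((mem_solidHarmonics.mp (pairSum_mem_solidHarmonics hij hjk hki)).1).pow 3)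
  have h2 : ∫ ω, restrictSphere n (pairSum i j k ^ 3) ω ∂(surf n) =
      ∫ ω, restrictSphere n (pairSum i j k) ω ^ 3 ∂(surf n) := by
    simp [restrictSphere_apply]
  rw [h2] at h1
  refine (mul_pos_iff_of_pos_left hc).mp ?_
  rw [← h1]
  let M : ℕ → ℕ → ℕ → MvPolynomial (Fin (n + 1)) ℝ := fun a b d =>
    MvPolynomial.monomial (Finsupp.single i a + Finsupp.single j b + Finsupp.single k d) 1
  have hM : ∀ a b d, M a b d =
      MvPolynomial.X i ^ a * MvPolynomial.X j ^ b * MvPolynomial.X k ^ d := by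
    intro a b d
    simp only [M, MvPolynomial.X_pow_eq_monomial, MvPolynomial.monomial_mul, mul_one]
  have hexp : pairSum i j k ^ 3 = (6 : ℝ) • M 2 2 2 +
      (M 3 3 0 + M 0 3 3 + M 3 0 3 + (3 : ℝ) • (M 2 3 1 + M 3 2 1 + M 1 3 2 + M 1 2 3 + M 3 1 2 +
        M 2 1 3)) := by
    simp only [hM, pairSum, MvPolynomial.smul_eq_C_mul, map_ofNat]
    ring
  have ei : ∀ a b d : ℕ, (Finsupp.single i a + Finsupp.single j b + Finsupp.single k d :
      Fin (n + 1) →₀ ℕ) i = a := by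
    intro a b d
    simp [hij.symm, hki]
  have ej : ∀ a b d : ℕ, (Finsupp.single i a + Finsupp.single j b + Finsupp.single k d :
      Fin (n + 1) →₀ ℕ) j = b := by
    intro a b d
    simp [hij, hjk.symm]
  have ek : ∀ a b d : ℕ, (Finsupp.single i a + Finsupp.single j b + Finsupp.single k d :
      Fin (n + 1) →₀ ℕ) k = d := by
    intro a b d
    simp [hjk, hki.symm]
  have zi : ∀ a b d : ℕ, Odd a → gaussIntegral _ (M a b d) = 0 := fun a b d ha =>
    gaussIntegral_monomial_eq_zero (i := i) (by rwa [ei]) 1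
  have zj : ∀ a b d : ℕ, Odd b → gaussIntegral _ (M a b d) = 0 := fun a b d ha =>
    gaussIntegral_monomial_eq_zero (i := j) (by rwa [ej]) 1
  have zk : ∀ a b d : ℕ, Odd d → gaussIntegral _ (M a b d) = 0 := fun a b d ha =>
    gaussIntegral_monomial_eq_zero (i := k) (by rwa [ek]) 1
  have hpos : 0 < gaussIntegral _ (M 2 2 2) := by
    refine gaussIntegral_monomial_pos (fun l => ?_) one_pos
    simp only [Finsupp.coe_add, Pi.add_apply, Finsupp.single_apply]
    refine ((?_ : Even _).add ?_).add ?_ <;> split_ifs <;> decide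
  have o1 : Odd 1 := by decide
  have o3 : Odd 3 := by decide
  rw [hexp]
  simp only [map_add, map_smul, smul_eq_mul, zi 3 _ _ o3, zj _ 3 _ o3, zk _ _ 3 o3]
  linarith

/-- Otherwise the function would vanish almost everywhere, and its cube would integrate to zero. -/
theorem integral_pairSum_sq_pos (hij : i ≠ j) (hjk : j ≠ k) (hki : k ≠ i) :
    0 < ∫ ω, restrictSphere n (pairSum i j k) ω ^ 2 ∂(surf n) := by
  set f := restrictSphere n (pairSum i j k) with hf
  refine lt_of_le_of_ne (integral_nonneg fun ω => sq_nonneg _) fun h0 => ?_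
  have hae : (fun ω => f ω ^ 2) =ᵐ[surf n] 0 :=
    (integral_eq_zero_iff_of_nonneg (fun ω => sq_nonneg _)
      (integrable_continuousMap (f ^ 2))).mp h0.symm
  have h3 : ∫ ω, f ω ^ 3 ∂(surf n) = 0 :=
    integral_eq_zero_of_ae (hae.mono fun ω hω => by
      have : f ω = 0 := by simpa using hω
      simp [this])
  exact (integral_pairSum_cube_pos hij hjk hki).ne' h3

end pairSum

/-! ### The eigenvalues -/

section alpha

variable {n : ℕ} {s : ℝ}

/-- The functional equation of Γ in numerator and denominator. It also applies at ℓ = 0, where n/2 -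
s is negative but nonzero. -/
theorem alpha_succ (hs : s - (n : ℝ) / 2 ∈ Ioo (0 : ℝ) 1) (ℓ : ℕ) :
    alpha n s (ℓ + 1) * (ℓ + n / 2 - s) = alpha n s ℓ * (ℓ + n / 2 + s) := by
  obtain ⟨h0, h1⟩ := hs
  have hn : (0 : ℝ) ≤ n := n.cast_nonneg
  have hl : (0 : ℝ) ≤ ℓ := ℓ.cast_nonneg
  have hne : (ℓ : ℝ) + n / 2 - s ≠ 0 := by
    rcases Nat.eq_zero_or_pos ℓ with rfl | h
    · simp only [Nat.cast_zero]
      linarith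
    · have : (1 : ℝ) ≤ ℓ := by exact_mod_cast h
      linarith
  have hne' : (ℓ : ℝ) + n / 2 + s ≠ 0 := by linarith
  simp only [alpha, Nat.cast_add, Nat.cast_one]
  rw [show (ℓ : ℝ) + 1 + n / 2 + s = (ℓ + n / 2 + s) + 1 by ring,
    show (ℓ : ℝ) + 1 + n / 2 - s = (ℓ + n / 2 - s) + 1 by ring,
    Real.Gamma_add_one hne, Real.Gamma_add_one hne', mul_div_mul_comm, mul_right_comm,
    div_mul_cancel₀ _ hne, mul_comm]

theorem alpha_succ_pos (hs : s - (n : ℝ) / 2 ∈ Ioo (0 : ℝ) 1) (ℓ : ℕ) : 0 < alpha n s (ℓ + 1) := by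
  obtain ⟨h0, h1⟩ := hs
  have hn : (0 : ℝ) ≤ n := n.cast_nonneg
  have hl : (0 : ℝ) ≤ ℓ := ℓ.cast_nonneg
  simp only [alpha, Nat.cast_add, Nat.cast_one]
  exact div_pos (Real.Gamma_pos_of_pos (by linarith)) (Real.Gamma_pos_of_pos (by linarith))

/-- The recursion from ℓ = 0 to 1 has one negative factor, n/2 - s. This single negative direction
is what makes the Sobolev inequality a reverse one. -/
theorem alpha_zero_neg (hs : s - (n : ℝ) / 2 ∈ Ioo (0 : ℝ) 1) : alpha n s 0 < 0 := by
  have h := alpha_succ hs 0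
  have h1 := alpha_succ_pos hs 0
  obtain ⟨h2, h3⟩ := hs
  have hn : (0 : ℝ) ≤ n := n.cast_nonneg
  simp only [Nat.cast_zero, zero_add] at h h1
  by_contra! hc
  have h4 : 0 ≤ alpha n s 0 * (n / 2 + s) := mul_nonneg hc (by linarith)
  have h5 : alpha n s 1 * (n / 2 - s) < 0 := mul_neg_of_pos_of_neg h1 (by linarith)
  linarith

/-- With x = ℓ + 1 + n/2 - s, consecutive ratios satisfy 1 + 2s/x ≤ (1 + 1/x)^{2s} by Bernoulli, and
the right-hand sides telescope. -/
theorem alpha_succ_le (hn : 2 ≤ n) (hs : s - (n : ℝ) / 2 ∈ Ioo (0 : ℝ) 1) (ℓ : ℕ) :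
    alpha n s (ℓ + 1) ≤ alpha n s 1 / (1 + n / 2 - s) ^ (2 * s) * (ℓ + 1 + n / 2 - s) ^ (2 * s) := by
  have h2 : (2 : ℝ) ≤ n := by exact_mod_cast hn
  have hpos := hs
  obtain ⟨h0, h1⟩ := hpos
  induction ℓ with
  | zero =>
    have : (0 : ℝ) < (1 + n / 2 - s) ^ (2 * s) := Real.rpow_pos_of_pos (by linarith) _
    simp only [zero_add, Nat.cast_zero]
    rw [div_mul_cancel₀ _ this.ne']
  | succ ℓ ih =>
    have hl : (0 : ℝ) ≤ ℓ := ℓ.cast_nonneg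
    set C := alpha n s 1 / (1 + n / 2 - s) ^ (2 * s)
    have hC : 0 ≤ C := div_nonneg (alpha_succ_pos hs 0).le (Real.rpow_nonneg (by linarith) _)
    set x : ℝ := ℓ + 1 + n / 2 - s with hx
    have hx0 : 0 < x := by linarith
    have hr := alpha_succ hs (ℓ + 1)
    push_cast at hr ⊢
    have hb : 1 + 2 * s * (1 / x) ≤ (1 + 1 / x) ^ (2 * s) :=
      one_add_mul_self_le_rpow_one_add (by have : 0 < 1 / x := by positivity
                                           linarith) (by linarith)
    have he : alpha n s (ℓ + 1 + 1) = alpha n s (ℓ + 1) * (1 + 2 * s * (1 / x)) := by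
      have : alpha n s (ℓ + 1 + 1) * x = alpha n s (ℓ + 1) * (x + 2 * s) := by
        rw [hx]
        rw [hr]
        ring
      field_simp
      linarith
    have hmul : x ^ (2 * s) * (1 + 1 / x) ^ (2 * s) = (ℓ + 1 + 1 + n / 2 - s) ^ (2 * s) := by
      rw [← Real.mul_rpow hx0.le (by positivity)]
      congr 1
      field_simp
      rw [hx]
      ring
    rw [he, ← hmul, ← mul_assoc]
    exact mul_le_mul ih hb (by have : 0 < 1 / x := by positivity
                               nlinarith) (mul_nonneg hC (Real.rpow_nonneg hx0.le _))

/-- The eigenvalues grow no faster than the Hˢ weights. Summability matters because `tsum` is zero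
on divergent series. -/
theorem summable_alpha_mul_norm_sq (hn : 2 ≤ n) (hs : s - (n : ℝ) / 2 ∈ Ioo (0 : ℝ) 1) {f : L2 n}
    (hf : MemHs n s f) : Summable fun ℓ => alpha n s ℓ * ‖proj n ℓ f‖ ^ 2 := by
  have h2 : (2 : ℝ) ≤ n := by exact_mod_cast hn
  rw [← summable_nat_add_iff 1]
  set C := alpha n s 1 / (1 + n / 2 - s) ^ (2 * s)
  have hC : 0 ≤ C := div_nonneg (alpha_succ_pos hs 0).le (Real.rpow_nonneg (by linarith [hs.2]) _)
  refine Summable.of_nonneg_of_le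
    (fun ℓ => mul_nonneg (alpha_succ_pos hs ℓ).le (sq_nonneg _)) (fun ℓ => ?_)
    (((summable_nat_add_iff 1).mpr hf).mul_left C)
  rw [← mul_assoc]
  refine mul_le_mul_of_nonneg_right ((alpha_succ_le hn hs ℓ).trans ?_) (sq_nonneg _)
  refine mul_le_mul_of_nonneg_left ?_ hC
  obtain ⟨h0, h1⟩ := hs
  have hl : (0 : ℝ) ≤ ℓ := ℓ.cast_nonneg
  rw [Real.rpow_mul (by linarith)]
  refine Real.rpow_le_rpow (Real.rpow_nonneg (by linarith) _) ?_ (by linarith)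
  rw [Real.rpow_two]
  push_cast
  nlinarith

end alpha

/-! ### The quadratic form on `Hˢ` -/

section bilin

variable {n : ℕ} {s : ℝ} {f g h : L2 n}

/-- Applied to h = u - ρ, this gives the regularity of h without estimating the harmonic components
of an optimizer. -/
theorem MemHs.sub (hf : MemHs n s f) (hg : MemHs n s g) : MemHs n s (f - g) := by
  have hw : ∀ ℓ : ℕ, (0 : ℝ) ≤ (1 + (ℓ : ℝ) * (ℓ + n - 1)) ^ s := fun ℓ => by
    refine Real.rpow_nonneg ?_ _
    rcases Nat.eq_zero_or_pos ℓ with rfl | hl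
    · simp
    · have : (1 : ℝ) ≤ ℓ := by exact_mod_cast hl
      have : (0 : ℝ) ≤ n := n.cast_nonneg
      nlinarith
  refine Summable.of_nonneg_of_le (fun ℓ => mul_nonneg (hw ℓ) (sq_nonneg _)) (fun ℓ => ?_)
    ((Summable.add hf hg).mul_left 2)
  rw [← mul_add, mul_left_comm]
  refine mul_le_mul_of_nonneg_left ?_ (hw ℓ)
  rw [map_sub]
  nlinarith [norm_sub_le (proj n ℓ f) (proj n ℓ g), norm_nonneg (proj n ℓ f - proj n ℓ g),
    sq_nonneg (‖proj n ℓ f‖ - ‖proj n ℓ g‖)]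

theorem summable_bilin (hn : 2 ≤ n) (hs : s - (n : ℝ) / 2 ∈ Ioo (0 : ℝ) 1) (hf : MemHs n s f)
    (hg : MemHs n s g) :
    Summable fun ℓ => alpha n s ℓ * inner ℝ (proj n ℓ f) (proj n ℓ g) := by
  refine Summable.of_norm_bounded ((summable_alpha_mul_norm_sq hn hs hf).norm.add
    (summable_alpha_mul_norm_sq hn hs hg).norm) fun ℓ => ?_
  rw [norm_mul, norm_mul, norm_mul, ← mul_add]
  refine mul_le_mul_of_nonneg_left ?_ (norm_nonneg _)
  simp only [norm_pow, norm_norm]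
  nlinarith [norm_inner_le_norm (𝕜 := ℝ) (proj n ℓ f) (proj n ℓ g), norm_nonneg (proj n ℓ f),
    norm_nonneg (proj n ℓ g), sq_nonneg (‖proj n ℓ f‖ - ‖proj n ℓ g‖)]

theorem bilin_comm : bilin n s f g = bilin n s g f := by
  exact tsum_congr fun ℓ => by rw [real_inner_comm]

theorem bilin_self : bilin n s f f = quad n s f := by
  simp only [bilin, quad, real_inner_self_eq_norm_sq]

theorem bilin_add_right (hn : 2 ≤ n) (hs : s - (n : ℝ) / 2 ∈ Ioo (0 : ℝ) 1) (hf : MemHs n s f)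
    (hg : MemHs n s g) (hh : MemHs n s h) :
    bilin n s f (g + h) = bilin n s f g + bilin n s f h := by
  simp only [bilin, map_add, inner_add_right, mul_add]
  exact (summable_bilin hn hs hf hg).tsum_add (summable_bilin hn hs hf hh)

/-- The discarded terms, of degree at least two, have positive eigenvalues. -/
theorem alpha_mul_norm_proj_le_quad (hn : 2 ≤ n) (hs : s - (n : ℝ) / 2 ∈ Ioo (0 : ℝ) 1)
    (hf : MemHs n s f) :
    alpha n s 0 * ‖proj n 0 f‖ ^ 2 + alpha n s 1 * ‖proj n 1 f‖ ^ 2 ≤ quad n s f := by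
  have := (summable_alpha_mul_norm_sq hn hs hf).sum_le_tsum (Finset.range 2) fun ℓ hℓ => by
    obtain ⟨m, rfl⟩ := Nat.exists_eq_add_of_le' (show 1 ≤ ℓ by
      have := Finset.mem_range.not.mp hℓ
      omega)
    exact mul_nonneg (alpha_succ_pos hs m).le (sq_nonneg _)
  simpa [Finset.sum_range_succ, quad] using this

/-- The projection onto the constants is at most the mean value in norm. -/
theorem norm_proj_zero_sq_mul_le (f : L2 n) :
    ‖proj n 0 f‖ ^ 2 * (surf n).real univ ≤ (inner ℝ f (toL2 n 1)) ^ 2 := by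
  obtain ⟨P, hP, hPf⟩ := Submodule.mem_map.mp
    (Submodule.starProjection_apply_mem (sphericalHarmonics n 0) f)
  have h1 : restrictSphere n 1 = 1 := by
    ext ω
    exact restrictSphere_one ω
  obtain ⟨t, ht⟩ : ∃ t : ℝ, proj n 0 f = t • toL2 n 1 := by
    have hdeg : P.totalDegree = 0 := Nat.le_zero.mp (mem_solidHarmonics.mp hP).1.totalDegree_le
    rw [MvPolynomial.totalDegree_eq_zero_iff_eq_C] at hdeg
    refine ⟨P.coeff 0, ?_⟩
    have : P = P.coeff 0 • 1 := by rw [MvPolynomial.smul_eq_C_mul, mul_one, ← hdeg]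
    rw [this] at hPf
    refine hPf.symm.trans ?_
    rw [LinearMap.map_smul, LinearMap.comp_apply, h1]
    rfl
  have hV : ‖toL2 n 1‖ ^ 2 = (surf n).real univ := by
    rw [norm_toL2_sq]
    simp
  have hin : ‖proj n 0 f‖ ^ 2 = t * inner ℝ f (toL2 n 1) := by
    rw [← real_inner_self_eq_norm_sq, inner_proj_proj, ht, inner_smul_right]
  have hin' : ‖proj n 0 f‖ ^ 2 = t ^ 2 * (surf n).real univ := by
    rw [ht, norm_smul, mul_pow, hV, Real.norm_eq_abs, sq_abs]
  -- By `hin` and `hin'` this square equals the right side of the claim minus the left.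
  nlinarith [sq_nonneg (t * (surf n).real univ - inner ℝ f (toL2 n 1))]

theorem inner_sq_le_norm_proj_sq_mul {l : ℕ} {P : MvPolynomial (Fin (n + 1)) ℝ}
    (hP : P ∈ solidHarmonics n l) (f : L2 n) :
    (inner ℝ f (toL2 n (restrictSphere n P))) ^ 2 ≤
      ‖proj n l f‖ ^ 2 * ‖toL2 n (restrictSphere n P)‖ ^ 2 := by
  have : inner ℝ f (toL2 n (restrictSphere n P)) =
      inner ℝ (proj n l f) (toL2 n (restrictSphere n P)) := by
    rw [← proj_restrictSphere_self hP, inner_proj_proj]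
  rw [this, ← mul_pow]
  exact sq_le_sq' (by linarith [neg_le_of_abs_le (abs_real_inner_le_norm (proj n l f)
    (toL2 n (restrictSphere n P)))]) (real_inner_le_norm _ _)

end bilin

/-! ### Elementary inequalities for powers -/

theorem one_add_mul_le_rpow_of_nonpos {p x : ℝ} (hp : p ≤ 0) (hx : -1 < x) :
    1 + p * x ≤ (1 + x) ^ p := by
  have h0 : 0 < 1 + x := by linarith
  rw [Real.rpow_def_of_pos h0]
  have h1 := Real.log_le_sub_one_of_pos h0
  have h2 := Real.add_one_le_exp (Real.log (1 + x) * p)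
  nlinarith

/-- The fourth derivative of (1 + x)^q is nonnegative, so the cubic Taylor polynomial lies below.
Concretely, F' = qG with G decreasing by the tangent-line bound for exponent q - 2; hence F is least
at 0. -/
theorem cubic_le_rpow {q x : ℝ} (hq : q ≤ 0) (hx : -1 < x) :
    1 + q * x + q * (q - 1) / 2 * x ^ 2 + q * (q - 1) * (q - 2) / 6 * x ^ 3 ≤ (1 + x) ^ q := by
  have hd : ∀ (p y : ℝ), -1 < y → HasDerivAt (fun y : ℝ => (1 + y) ^ p) (p * (1 + y) ^ (p - 1)) y := by
    intro p y hy
    have := ((hasDerivAt_id y).const_add 1).rpow_const (p := p) (Or.inl (by simp; linarith))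
    simpa using this
  have hpoly : ∀ (a b c y : ℝ), HasDerivAt (fun y : ℝ => 1 + a * y + b * y ^ 2 + c * y ^ 3)
      (a + 2 * b * y + 3 * c * y ^ 2) y := by
    intro a b c y
    have := ((((hasDerivAt_id y).const_mul a).const_add 1).add ((hasDerivAt_pow 2 y).const_mul b)).add
      ((hasDerivAt_pow 3 y).const_mul c)
    refine this.congr_deriv ?_
    simp
    ring
  set G : ℝ → ℝ := fun y => (1 + y) ^ (q - 1) -
    (1 + (q - 1) * y + (q - 1) * (q - 2) / 2 * y ^ 2 + 0 * y ^ 3) with hG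
  have hGd : ∀ y, -1 < y → HasDerivAt G ((q - 1) * ((1 + y) ^ (q - 2) - (1 + (q - 2) * y))) y := by
    intro y hy
    refine ((hd (q - 1) y hy).sub (hpoly _ _ _ y)).congr_deriv ?_
    rw [show q - 1 - 1 = q - 2 by ring]
    ring
  have hGanti : AntitoneOn G (Ioi (-1)) := by
    refine antitoneOn_of_deriv_nonpos (convex_Ioi _)
      (fun y hy => (hGd y hy).continuousAt.continuousWithinAt)
      (fun y hy => ?_) fun y hy => ?_
    · rw [interior_Ioi] at hy
      exact (hGd y hy).differentiableAt.differentiableWithinAt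
    · rw [interior_Ioi] at hy
      rw [(hGd y hy).deriv]
      have := one_add_mul_le_rpow_of_nonpos (p := q - 2) (by linarith) hy
      exact mul_nonpos_of_nonpos_of_nonneg (by linarith) (by linarith)
  have hG0 : G 0 = 0 := by simp [hG]
  set F : ℝ → ℝ := fun y => (1 + y) ^ q -
    (1 + q * y + q * (q - 1) / 2 * y ^ 2 + q * (q - 1) * (q - 2) / 6 * y ^ 3) with hF
  have hFd : ∀ y, -1 < y → HasDerivAt F (q * G y) y := by
    intro y hy
    refine ((hd q y hy).sub (hpoly _ _ _ y)).congr_deriv ?_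
    simp only [hG]
    ring
  have hF0 : F 0 = 0 := by simp [hF]
  have key : 0 ≤ F x := by
    rw [← hF0]
    rcases le_total 0 x with h | h
    · refine monotoneOn_of_deriv_nonneg (convex_Ici 0)
        (fun y hy => (hFd y (by linarith [mem_Ici.mp hy])).continuousAt.continuousWithinAt)
        (fun y hy => ?_) (fun y hy => ?_) self_mem_Ici h h <;> rw [interior_Ici] at hy <;>
        have hy' : -1 < y := by linarith [mem_Ioi.mp hy]
      · exact (hFd y hy').differentiableAt.differentiableWithinAt
      · rw [(hFd y hy').deriv]
        have := hGanti (by norm_num : (0 : ℝ) ∈ Ioi (-1)) hy' (mem_Ioi.mp hy).le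
        exact mul_nonneg_of_nonpos_of_nonpos hq (by linarith)
    · refine antitoneOn_of_deriv_nonpos (convex_Ioc (-1) 0)
        (fun y hy => (hFd y hy.1).continuousAt.continuousWithinAt)
        (fun y hy => ?_) (fun y hy => ?_) ⟨hx, h⟩ ⟨by norm_num, le_refl 0⟩ h <;>
        rw [interior_Ioc] at hy
      · exact (hFd y hy.1).differentiableAt.differentiableWithinAt
      · rw [(hFd y hy.1).deriv]
        have := hGanti hy.1 (by norm_num : (0 : ℝ) ∈ Ioi (-1)) hy.2.le
        exact mul_nonpos_of_nonpos_of_nonneg hq (by linarith)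
  simp only [hF] at key
  linarith

section sub_rpow

variable {γ x : ℝ}

theorem sub_rpow_le (h0 : 0 < γ) (h1 : γ < 1) (hx : |x| < 1) : (1 - x) ^ γ ≤ 1 - γ * x := by
  have := rpow_one_add_le_one_add_mul_self (s := -x) (by linarith [(abs_lt.mp hx).2]) h0.le h1.le
  rw [← sub_eq_add_neg] at this
  linarith

/-- Multiply the tangent-line bound for (1 - x)^{γ-1} by 1 - x. -/
theorem le_sub_rpow (h1 : γ < 1) (hx : |x| < 1) :
    1 - γ * x - (1 - γ) * x ^ 2 ≤ (1 - x) ^ γ := by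
  have hx' : 0 < 1 - x := by linarith [(abs_lt.mp hx).2]
  have h := one_add_mul_le_rpow_of_nonpos (p := γ - 1) (x := -x) (by linarith)
    (by linarith [(abs_lt.mp hx).2])
  rw [← sub_eq_add_neg, Real.rpow_sub_one hx'.ne', le_div_iff₀ hx'] at h
  nlinarith

theorem mul_sub_rpow_le (h0 : 0 < γ) (h1 : γ < 1) (hx : |x| < 1) :
    (1 - x) ^ γ * x ≤ x - γ / 2 * x ^ 2 := by
  obtain ⟨hx1, hx2⟩ := abs_lt.mp hx
  rcases le_total 0 x with h | h
  · nlinarith [sub_rpow_le h0 h1 hx, mul_nonneg h0.le (sq_nonneg x)]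
  -- For negative x a lower bound on (1 - x)^γ is needed. Bernoulli for the reciprocal 1/(1 - x)
  -- gives (1 - x)/(1 - x + γx), which is at least 1 - γx/2 because x > -1.
  · have hy : 0 < 1 - x := by linarith
    have ha : 0 < (1 - x) ^ γ := Real.rpow_pos_of_pos hy _
    have hz : |-x / (1 - x)| < 1 := by
      rw [abs_of_nonneg (div_nonneg (by linarith) hy.le), div_lt_one hy]
      linarith
    have hb := sub_rpow_le h0 h1 hz
    have hinv : 1 - -x / (1 - x) = (1 - x)⁻¹ := by
      field_simp
      ring
    rw [hinv, Real.inv_rpow hy.le, inv_le_iff_one_le_mul₀ ha] at hb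
    have hc : 1 - x ≤ (1 - x + γ * x) * (1 - x) ^ γ := by
      have := mul_le_mul_of_nonneg_left hb hy.le
      rw [mul_one] at this
      refine this.trans_eq ?_
      field_simp
      ring
    have hd : 0 < 1 - x + γ * x := by nlinarith
    have he : 1 - γ / 2 * x ≤ (1 - x) ^ γ := by
      by_contra! hlt
      have := mul_lt_mul_of_pos_left hlt hd
      nlinarith [mul_nonneg h0.le (neg_nonneg.mpr h), mul_nonneg (mul_nonneg h0.le (neg_nonneg.mpr h))
        (by nlinarith : 0 ≤ 1 + x - γ * x)]
    nlinarith

end sub_rpow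

/-- An upper bound for `(1 + A) ^ r` that is sharp to first order. -/
theorem one_add_rpow_le {A r : ℝ} (hA : 0 ≤ A) (hr : -1 ≤ r) (hr' : r ≤ 0) :
    (1 + A) ^ r ≤ 1 + r * A / (1 + A) := by
  have hpos : 0 < 1 + A := by linarith
  have h := rpow_one_add_le_one_add_mul_self (s := A) (by linarith) (p := r + 1) (by linarith)
    (by linarith)
  rw [Real.rpow_add_one hpos.ne', ← le_div_iff₀ hpos] at h
  refine h.trans_eq ?_
  field_simp
  ring

/-! ### The constant in the reverse Sobolev inequality -/

theorem surf_real_univ_pos (n : ℕ) : 0 < (surf n).real univ := by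
  rw [measureReal_def]
  exact ENNReal.toReal_pos (Measure.measure_univ_ne_zero.mpr (Measure.toSphere_ne_zero _))
    (measure_ne_top _ _)

/-- Legendre's duplication formula brings 2π^{(n+1)/2}/Γ((n+1)/2) to the shape occurring in
`sobolevConst`. -/
theorem surf_real_univ {n : ℕ} (hn : 0 < n) :
    (surf n).real univ =
      (4 * Real.pi) ^ ((n : ℝ) / 2) * (Real.Gamma (n / 2) / Real.Gamma n) := by
  have hn' : (0 : ℝ) < n := by exact_mod_cast hn
  have h1 : (surf n).real univ = 2 * √Real.pi ^ (n + 1) / Real.Gamma (n / 2 + 1 / 2) := by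
    have hg : Real.Gamma (((n : ℝ) + 1) / 2 + 1) =
        ((n + 1) / 2) * Real.Gamma (n / 2 + 1 / 2) := by
      rw [Real.Gamma_add_one (by positivity), add_div]
    have hpos : 0 < Real.Gamma ((n : ℝ) / 2 + 1 / 2) := Real.Gamma_pos_of_pos (by positivity)
    rw [Measure.toSphere_real_apply_univ, measureReal_def, EuclideanSpace.volume_ball]
    simp only [finrank_euclideanSpace, Fintype.card_fin, ENNReal.ofReal_one, one_pow, one_mul]
    rw [ENNReal.toReal_ofReal (div_nonneg (by positivity) (Real.Gamma_pos_of_pos (by positivity)).le)]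
    push_cast
    rw [hg]
    field_simp
  have h2 := Real.Gamma_mul_Gamma_add_half ((n : ℝ) / 2)
  rw [mul_div_cancel₀ (n : ℝ) two_ne_zero] at h2
  have h3 : (4 * Real.pi) ^ ((n : ℝ) / 2) = 2 ^ n * √Real.pi ^ n := by
    rw [Real.mul_rpow (by norm_num) Real.pi_pos.le, show (4 : ℝ) = 2 ^ (2 : ℝ) by norm_num,
      ← Real.rpow_mul (by norm_num), mul_div_cancel₀ (n : ℝ) two_ne_zero, Real.rpow_natCast,
      Real.sqrt_eq_rpow, ← Real.rpow_natCast (Real.pi ^ (1 / 2 : ℝ)), ← Real.rpow_mul Real.pi_pos.le]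
    congr 2
    ring
  have h4 : (2 : ℝ) ^ (1 - (n : ℝ)) = 2 / 2 ^ n := by
    rw [Real.rpow_sub two_pos, Real.rpow_one, Real.rpow_natCast]
  have hg1 : 0 < Real.Gamma ((n : ℝ) / 2 + 1 / 2) := Real.Gamma_pos_of_pos (by positivity)
  have hg2 : 0 < Real.Gamma (n : ℝ) := Real.Gamma_pos_of_pos hn'
  rw [h1, h3]
  rw [h4] at h2
  field_simp at h2 ⊢
  rw [pow_succ]
  linear_combination (-√Real.pi ^ n) * h2

/-- This is the equality case of the reverse Sobolev inequality at the constant function 1. -/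
theorem sobolevConst_mul_rpow {n : ℕ} (hn : 0 < n) (s : ℝ) :
    sobolevConst n s * (surf n).real univ ^ (((n : ℝ) - 2 * s) / n) =
      alpha n s 0 * (surf n).real univ := by
  have hn' : (0 : ℝ) < n := by exact_mod_cast hn
  have hV := surf_real_univ_pos n
  have hW : 0 < Real.Gamma ((n : ℝ) / 2) / Real.Gamma n :=
    div_pos (Real.Gamma_pos_of_pos (by positivity)) (Real.Gamma_pos_of_pos hn')
  have hS : sobolevConst n s = alpha n s 0 * (surf n).real univ ^ (2 * s / n) := by
    rw [surf_real_univ hn, Real.mul_rpow (Real.rpow_nonneg (by positivity) _) hW.le,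
      ← Real.rpow_mul (by positivity), show (n : ℝ) / 2 * (2 * s / n) = s by field_simp, sobolevConst,
      alpha, Nat.cast_zero, zero_add, add_div, sub_div, mul_div_cancel_left₀ s two_ne_zero]
    ring
  rw [hS, mul_assoc, ← Real.rpow_add hV]
  congr 1
  rw [show 2 * s / n + ((n : ℝ) - 2 * s) / n = 1 by field_simp; ring, Real.rpow_one]

/-! ### The test functions -/

/-- The perturbation `1 - δ (ω_i ω_j + ω_j ω_k + ω_k ω_i)` of the constant function. -/
noncomputable def testFunction {n : ℕ} (i j k : Fin (n + 1)) (δ : ℝ) : C(Sph n, ℝ) :=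
  restrictSphere n 1 - δ • restrictSphere n (pairSum i j k)

section testFunction

variable {n : ℕ} {s δ : ℝ} {i j k : Fin (n + 1)}

theorem testFunction_apply (ω : Sph n) :
    testFunction i j k δ ω = 1 - δ * restrictSphere n (pairSum i j k) ω := by
  simp [testFunction, restrictSphere_one]

theorem toL2_testFunction : toL2 n (testFunction i j k δ) =
    toL2 n (restrictSphere n 1) - δ • toL2 n (restrictSphere n (pairSum i j k)) := by
  simp [testFunction]

theorem testFunction_pos (hδ : 0 ≤ δ) (hδ' : 3 * δ < 1) (ω : Sph n) :
    0 < testFunction i j k δ ω := by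
  rw [testFunction_apply]
  have := abs_le.mp (abs_restrictSphere_pairSum_le (i := i) (j := j) (k := k) ω)
  nlinarith

theorem integral_pairSum (hij : i ≠ j) (hjk : j ≠ k) (hki : k ≠ i) :
    ∫ ω, restrictSphere n (pairSum i j k) ω ∂(surf n) = 0 := by
  simpa [restrictSphere_one] using integral_solidHarmonics_mul_eq_zero (by decide : 2 ≠ 0)
    (pairSum_mem_solidHarmonics hij hjk hki) (one_mem_solidHarmonics n)

theorem proj_testFunction_eq_zero (hij : i ≠ j) (hjk : j ≠ k) (hki : k ≠ i) {ℓ : ℕ} (h0 : ℓ ≠ 0)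
    (h2 : ℓ ≠ 2) : proj n ℓ (toL2 n (testFunction i j k δ)) = 0 := by
  rw [toL2_testFunction, map_sub, map_smul,
    proj_restrictSphere_of_ne h0.symm (one_mem_solidHarmonics n),
    proj_restrictSphere_of_ne h2.symm (pairSum_mem_solidHarmonics hij hjk hki), smul_zero, sub_zero]

theorem memHs_testFunction (hij : i ≠ j) (hjk : j ≠ k) (hki : k ≠ i) :
    MemHs n s (toL2 n (testFunction i j k δ)) := by
  refine summable_of_ne_finset_zero (s := {0, 2}) fun ℓ hℓ => ?_
  simp only [Finset.mem_insert, Finset.mem_singleton, not_or] at hℓ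
  rw [proj_testFunction_eq_zero hij hjk hki hℓ.1 hℓ.2]
  simp

theorem bilin_testFunction (hij : i ≠ j) (hjk : j ≠ k) (hki : k ≠ i) (f : L2 n) :
    bilin n s f (toL2 n (testFunction i j k δ)) =
      alpha n s 0 * inner ℝ f (toL2 n (restrictSphere n 1)) -
        δ * alpha n s 2 * inner ℝ f (toL2 n (restrictSphere n (pairSum i j k))) := by
  have h1 := one_mem_solidHarmonics n
  have h2 := pairSum_mem_solidHarmonics hij hjk hki
  rw [bilin, tsum_eq_sum (s := {0, 2}) fun ℓ hℓ => by
    simp only [Finset.mem_insert, Finset.mem_singleton, not_or] at hℓ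
    rw [proj_testFunction_eq_zero hij hjk hki hℓ.1 hℓ.2, inner_zero_right, mul_zero],
    Finset.sum_pair (by decide), inner_proj_proj, inner_proj_proj, toL2_testFunction, map_sub,
    map_smul, map_sub, map_smul, proj_restrictSphere_self h1, proj_restrictSphere_self h2,
    proj_restrictSphere_of_ne (by decide) h1, proj_restrictSphere_of_ne (by decide) h2, smul_zero,
    sub_zero, zero_sub, inner_neg_right, inner_smul_right]
  ring

theorem quad_testFunction (hij : i ≠ j) (hjk : j ≠ k) (hki : k ≠ i) :
    quad n s (toL2 n (testFunction i j k δ)) = alpha n s 0 * (surf n).real univ +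
      δ ^ 2 * alpha n s 2 * ∫ ω, restrictSphere n (pairSum i j k) ω ^ 2 ∂(surf n) := by
  rw [← bilin_self, bilin_testFunction hij hjk hki, inner_toL2, inner_toL2]
  have e1 : ∫ ω, testFunction i j k δ ω * restrictSphere n 1 ω ∂(surf n) = (surf n).real univ := by
    simp only [testFunction_apply, restrictSphere_one, mul_one]
    rw [integral_sub (integrable_const _) ((integrable_continuousMap _).const_mul _),
      integral_const_mul, integral_pairSum hij hjk hki]
    simp
  have e2 : ∫ ω, testFunction i j k δ ω * restrictSphere n (pairSum i j k) ω ∂(surf n) =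
      -δ * ∫ ω, restrictSphere n (pairSum i j k) ω ^ 2 ∂(surf n) := by
    simp only [testFunction_apply, sub_mul, one_mul, mul_assoc, ← pow_two]
    have i2 : Integrable (fun ω => restrictSphere n (pairSum i j k) ω ^ 2) (surf n) :=
      integrable_continuousMap (restrictSphere n (pairSum i j k) ^ 2)
    rw [integral_sub (integrable_continuousMap _) (i2.const_mul _), integral_const_mul, integral_pairSum hij hjk hki]
    ring
  rw [e1, e2]
  ring

/-- The test function is even, which forces ζ·ω = 0 for an optimizer. Then φ would be constant with
mean zero, contradicting ∫φ² > 0. -/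
theorem testFunction_notMem_optimizers (hs : s - (n : ℝ) / 2 ∈ Ioo (0 : ℝ) 1) (hij : i ≠ j)
    (hjk : j ≠ k) (hki : k ≠ i) (hδ : δ ≠ 0) : testFunction i j k δ ∉ optimizers n s := by
  rintro ⟨c, ζ, hc, hζ, h⟩
  have hγ : (2 * s - n) / 2 ≠ 0 := by
    have := hs.1
    intro h0
    linarith
  have hx : ∀ ω : Sph n, |inner ℝ ζ ω.1| < 1 := fun ω => by
    have := abs_real_inner_le_norm ζ ω.1
    rw [norm_eq_of_mem_sphere ω, mul_one] at this
    exact this.trans_lt hζ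
  have hzero : ∀ ω : Sph n, inner ℝ ζ ω.1 = 0 := by
    intro ω
    have heven : testFunction i j k δ (-ω) = testFunction i j k δ ω := by
      simp [testFunction_apply, restrictSphere_pairSum]
    rw [h, h, coe_neg_sphere, inner_neg_right] at heven
    have h1 := mul_left_cancel₀ hc.ne' heven
    have := abs_lt.mp (hx ω)
    have h2 := (Real.rpow_left_inj (by linarith) (by linarith) hγ).mp h1
    linarith
  have hφ : ∀ ω, restrictSphere n (pairSum i j k) ω = (1 - c) / δ := by
    intro ω
    have := h ω
    rw [hzero, sub_zero, Real.one_rpow, testFunction_apply] at this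
    field_simp
    linarith
  have h0 := integral_pairSum hij hjk hki
  simp only [hφ, integral_const, smul_eq_mul] at h0
  have hz := (mul_eq_zero.mp h0).resolve_left (surf_real_univ_pos n).ne'
  have hpos := integral_pairSum_sq_pos hij hjk hki
  simp [hφ, hz] at hpos

end testFunction

/-! ### The distance from the test functions to the manifold of optimizers -/

/-- ℳ is a cone. This scaling direction is the only tangent vector the distance estimate uses. -/
theorem mem_tangentSpace_self {n : ℕ} {s : ℝ} {h : C(Sph n, ℝ)} (hh : h ∈ optimizers n s) :
    h ∈ tangentSpace n s h := by
  obtain ⟨c, ζ, hc, hζ, hω⟩ := hh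
  refine ⟨1, fun t => (1 + t) • h, one_pos, fun t ht => ⟨(1 + t) * c, ζ, ?_, hζ, fun ω => ?_⟩,
    by simp, fun ω => ?_⟩
  · exact mul_pos (by linarith [ht.1]) hc
  · simp [hω ω, mul_assoc]
  · simpa using ((hasDerivAt_id (0 : ℝ)).const_add 1).mul_const (h ω)

/-- The integrals of `(1 - ζ · ω) ^ γ` against the spherical harmonics of degrees at most two. -/
theorem integral_optimizer_bounds {n : ℕ} {γ : ℝ} (h0 : 0 < γ) (h1 : γ < 1) {i j k : Fin (n + 1)}
    (hij : i ≠ j) (hjk : j ≠ k) (hki : k ≠ i) {ζ : EuclideanSpace ℝ (Fin (n + 1))} (hζ : ‖ζ‖ < 1)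
    {h : C(Sph n, ℝ)} (hh : ∀ ω : Sph n, h ω = (1 - inner ℝ ζ ω.1) ^ γ) :
    ∫ ω : Sph n, (inner ℝ ζ ω.1) ^ 2 ∂(surf n) ≤ (surf n).real univ ∧
    γ * (surf n).real univ ≤ ∫ ω, h ω ∂(surf n) ∧
    ∫ ω, h ω ∂(surf n) ≤ (surf n).real univ ∧
    ∫ ω, h ω * inner ℝ ζ ω.1 ∂(surf n) ≤
      -(γ / 2 * ∫ ω : Sph n, (inner ℝ ζ ω.1) ^ 2 ∂(surf n)) ∧
    |∫ ω, h ω * restrictSphere n (pairSum i j k) ω ∂(surf n)| ≤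
      3 * ∫ ω : Sph n, (inner ℝ ζ ω.1) ^ 2 ∂(surf n) := by
  set x : C(Sph n, ℝ) := restrictSphere n (linearForm ζ)
  set φ := restrictSphere n (pairSum i j k)
  have hxi : ∀ ω : Sph n, inner ℝ ζ ω.1 = x ω := fun ω => (restrictSphere_linearForm ζ ω).symm
  simp only [hxi] at hh ⊢
  have hx : ∀ ω, |x ω| < 1 := fun ω => by
    have := abs_real_inner_le_norm ζ ω.1
    rw [norm_eq_of_mem_sphere ω, mul_one, hxi] at this
    exact this.trans_lt hζ
  have ix := integrable_continuousMap x
  have ix2 : Integrable (fun ω => x ω ^ 2) (surf n) := integrable_continuousMap (x ^ 2)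
  have ih := integrable_continuousMap h
  have ihx : Integrable (fun ω => h ω * x ω) (surf n) := integrable_continuousMap (h * x)
  have ihφ : Integrable (fun ω => h ω * φ ω) (surf n) := integrable_continuousMap (h * φ)
  have ixφ : Integrable (fun ω => x ω * φ ω) (surf n) := integrable_continuousMap (x * φ)
  have iφ := integrable_continuousMap φ
  have i1 : Integrable (fun _ : Sph n => (1 : ℝ)) (surf n) := integrable_const _
  have e1 : ∫ _ : Sph n, (1 : ℝ) ∂(surf n) = (surf n).real univ := by simp
  have ex : ∫ ω, x ω ∂(surf n) = 0 := by
    simpa [restrictSphere_one] using integral_solidHarmonics_mul_eq_zero (by decide : 1 ≠ 0)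
      (linearForm_mem_solidHarmonics ζ) (one_mem_solidHarmonics n)
  have exφ : ∫ ω, x ω * φ ω ∂(surf n) = 0 :=
    integral_solidHarmonics_mul_eq_zero (by decide : 1 ≠ 2) (linearForm_mem_solidHarmonics ζ)
      (pairSum_mem_solidHarmonics hij hjk hki)
  have eφ : ∫ ω, φ ω ∂(surf n) = 0 := integral_pairSum hij hjk hki
  have hI : ∫ ω, x ω ^ 2 ∂(surf n) ≤ (surf n).real univ := by
    rw [← e1]
    exact integral_mono ix2 i1 fun ω => (sq_le_one_iff_abs_le_one _).mpr (hx ω).le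
  refine ⟨hI, ?_, ?_, ?_, ?_⟩
  · have : ∫ ω, (1 - γ * x ω - (1 - γ) * x ω ^ 2) ∂(surf n) ≤ ∫ ω, h ω ∂(surf n) :=
      integral_mono ((i1.sub (ix.const_mul _)).sub (ix2.const_mul _)) ih fun ω => by
        simp only [hh]
        exact le_sub_rpow h1 (hx ω)
    have i4 : Integrable (fun ω => 1 - γ * x ω) (surf n) := i1.sub (ix.const_mul _)
    rw [integral_sub i4 (ix2.const_mul _), integral_sub i1 (ix.const_mul _), integral_const_mul,
      integral_const_mul, ex, e1] at this
    nlinarith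
  · have : ∫ ω, h ω ∂(surf n) ≤ ∫ ω, (1 - γ * x ω) ∂(surf n) :=
      integral_mono ih (i1.sub (ix.const_mul _)) fun ω => by
        simp only [hh]
        exact sub_rpow_le h0 h1 (hx ω)
    rw [integral_sub i1 (ix.const_mul _), integral_const_mul, ex, e1] at this
    linarith
  · have : ∫ ω, h ω * x ω ∂(surf n) ≤ ∫ ω, (x ω - γ / 2 * x ω ^ 2) ∂(surf n) :=
      integral_mono ihx (ix.sub (ix2.const_mul _)) fun ω => by
        simp only [hh]
        exact mul_sub_rpow_le h0 h1 (hx ω)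
    rw [integral_sub ix (ix2.const_mul _), integral_const_mul, ex] at this
    linarith
  -- Since φ is orthogonal to degrees 0 and 1, the first-order part 1 - γx of h drops out; the
  -- remainder is at most x² in absolute value, and |φ| ≤ 3.
  · have heq : ∫ ω, h ω * φ ω ∂(surf n) = ∫ ω, (h ω - 1 + γ * x ω) * φ ω ∂(surf n) := by
      have : ∀ ω, (h ω - 1 + γ * x ω) * φ ω = h ω * φ ω - φ ω + γ * (x ω * φ ω) := fun ω => by ring
      simp only [this]
      have i4 : Integrable (fun ω => h ω * φ ω - φ ω) (surf n) := ihφ.sub iφ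
      rw [integral_add i4 (ixφ.const_mul _), integral_sub ihφ iφ, integral_const_mul,
        exφ, eφ]
      ring
    rw [heq, ← integral_const_mul]
    refine abs_integral_le_integral_abs.trans (integral_mono_of_nonneg
      (.of_forall fun ω => abs_nonneg _) (ix2.const_mul _) (.of_forall fun ω => ?_))
    simp only [abs_mul]
    rw [mul_comm (3 : ℝ)]
    refine mul_le_mul ?_ (abs_restrictSphere_pairSum_le ω) (abs_nonneg _) (sq_nonneg _)
    rw [hh, abs_le]
    have hle := sub_rpow_le h0 h1 (hx ω)
    have hge := le_sub_rpow h1 (hx ω)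
    constructor <;> nlinarith [sq_nonneg (x ω)]

/-- The algebra behind the lower bound for the distance: `H`, `L`, `Φ` are the integrals of an optimizer
against harmonics of degrees `0`, `1`, `2`, and `p0`, `p1` the squared norms of its projections. -/
theorem neg_mul_le_of_projection_bounds {a0 a1 a2 γ δ c V I H L Φ p0 p1 : ℝ} (ha0 : a0 < 0)
    (ha1 : 0 ≤ a1) (ha2 : 0 ≤ a2) (hγ0 : 0 < γ) (hδ : 0 ≤ δ) (hc : 0 < c) (hV : 0 < V) (hI0 : 0 ≤ I)
    (hδ1 : 3 * δ * a2 < -a0 * γ) (hδ2 : 24 * δ * a2 ≤ a1 * γ ^ 2) (hp : 0 ≤ p1)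
    (hP0 : p0 * V ≤ (c * H) ^ 2) (hP1 : (c * L) ^ 2 ≤ p1 * I) (bI : I ≤ V) (bH : γ * V ≤ H)
    (bH' : H ≤ V) (bL : L ≤ -(γ / 2 * I)) (bΦ : |Φ| ≤ 3 * I)
    (e3 : a0 * p0 + a1 * p1 ≤ a0 * (c * H) - δ * (a2 * (c * Φ))) :
    -a0 * V ≤ c * (-a0 * H + δ * (a2 * Φ)) := by
  -- Cauchy–Schwarz bounds the degree-one energy below after division by I; the case I = 0, that is
  -- ζ = 0, is separate.
  have hp1 : c ^ 2 * (γ ^ 2 / 4 * I) ≤ p1 := by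
    rcases hI0.eq_or_lt with hI | hI
    · rw [← hI]
      simpa using hp
    · have hL2 : (γ / 2 * I) ^ 2 ≤ L ^ 2 := by
        have : 0 ≤ γ / 2 * I := by positivity
        nlinarith
      have : c ^ 2 * (γ ^ 2 / 4 * I) * I ≤ p1 * I := by
        nlinarith [mul_le_mul_of_nonneg_left hL2 (sq_nonneg c)]
      exact le_of_mul_le_mul_right this hI
  obtain ⟨bΦ1, bΦ2⟩ := abs_le.mp bΦ
  -- Here cg = -a[h,u], and `hδ1` serves to make g positive.
  set g := -a0 * H + δ * (a2 * Φ) with hg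
  have hδa : 0 ≤ δ * a2 := by positivity
  have hΦ : -(δ * a2 * (3 * I)) ≤ δ * (a2 * Φ) := by
    have := mul_le_mul_of_nonneg_left bΦ1 hδa
    linarith
  have hH : 0 < H := lt_of_lt_of_le (by positivity) bH
  have hg0 : 0 < g := by
    have t1 : -a0 * (γ * V) ≤ -a0 * H := mul_le_mul_of_nonneg_left bH (by linarith)
    have t2 : δ * a2 * (3 * I) ≤ δ * a2 * (3 * V) := mul_le_mul_of_nonneg_left (by linarith) hδa
    have t3 := mul_lt_mul_of_pos_right hδ1 hV
    rw [hg]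
    linarith
  -- The quantity -c²J is a lower bound for V·a[h]. So `hcJ` bounds c from below, and with `hgJ`
  -- this gives -a0 V J ≤ g²V ≤ cgJ.
  set J := -a0 * H ^ 2 - a1 * (γ ^ 2 / 4 * I) * V with hJ
  have hcJ : g * V ≤ c * J := by
    have t1 : a0 * (c * H) ^ 2 ≤ a0 * (p0 * V) := mul_le_mul_of_nonpos_left hP0 ha0.le
    have t2 : a1 * (c ^ 2 * (γ ^ 2 / 4 * I)) * V ≤ a1 * p1 * V :=
      mul_le_mul_of_nonneg_right (mul_le_mul_of_nonneg_left hp1 ha1) hV.le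
    have t3 := mul_le_mul_of_nonneg_right e3 hV.le
    have t4 : c * (g * V) ≤ c * (c * J) := by
      rw [hg, hJ]
      linarith
    exact le_of_mul_le_mul_left t4 hc
  have hgJ : -a0 * J ≤ g ^ 2 := by
    have t1 : 0 ≤ -a0 * H := mul_nonneg (by linarith) hH.le
    have t2 : (-a0 * H) ^ 2 + 2 * (-a0 * H) * (δ * (a2 * Φ)) ≤ g ^ 2 := by
      have : g ^ 2 = (-a0 * H) ^ 2 + 2 * (-a0 * H) * (δ * (a2 * Φ)) + (δ * (a2 * Φ)) ^ 2 := by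
        rw [hg]
        ring
      linarith [sq_nonneg (δ * (a2 * Φ))]
    have t3 := mul_le_mul_of_nonneg_left hΦ t1
    -- The cross term of g² loses at most 6δ·a2·I·(-a0 H), which must fit into (-a0 V)·a1γ²I/4;
    -- hence the 24 in `hδ2`.
    have t4 : -a0 * H * (24 * δ * a2 * I) ≤ -a0 * V * (a1 * γ ^ 2 * I) := by
      refine mul_le_mul (mul_le_mul_of_nonneg_left bH' (by linarith))
        (mul_le_mul_of_nonneg_right hδ2 hI0) (by positivity) (mul_nonneg (by linarith) hV.le)
    rw [hJ]
    linarith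
  have hJ0 : 0 < J := by
    have : 0 < c * J := lt_of_lt_of_le (mul_pos hg0 hV) hcJ
    exact (mul_pos_iff_of_pos_left hc).mp this
  have t1 := mul_le_mul_of_nonneg_left hcJ hg0.le
  have t2 := mul_le_mul_of_nonneg_right hgJ hV.le
  have : -a0 * V * J ≤ c * g * J := by linarith
  exact le_of_mul_le_mul_right this hJ0

/-- If `u = h + ρ` with `h ∈ ℳ` and `ρ ∈ (T_h ℳ)^⊥`, where `u` is a test function close to `1`, then
`a_{2s}[ρ]` is at least the value for the decomposition with `h = 1`. -/
theorem le_quad_of_decomposition {n : ℕ} (hn : 2 ≤ n) {s : ℝ}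
    (hs : s - (n : ℝ) / 2 ∈ Ioo (0 : ℝ) 1) {i j k : Fin (n + 1)} (hij : i ≠ j) (hjk : j ≠ k)
    (hki : k ≠ i) {δ : ℝ} (hδ : 0 ≤ δ)
    (hδ1 : 3 * δ * alpha n s 2 < -alpha n s 0 * (s - n / 2))
    (hδ2 : 24 * δ * alpha n s 2 ≤ alpha n s 1 * (s - n / 2) ^ 2)
    {h : C(Sph n, ℝ)} (hh : h ∈ optimizers n s) {ρ : L2 n} (hρ : ρ ∈ tangentPerp n s h)
    (hu : toL2 n (testFunction i j k δ) = toL2 n h + ρ) :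
    δ ^ 2 * alpha n s 2 * ∫ ω, restrictSphere n (pairSum i j k) ω ^ 2 ∂(surf n) ≤ quad n s ρ := by
  set U := toL2 n (testFunction i j k δ) with hU
  have hUm : MemHs n s U := memHs_testFunction hij hjk hki
  obtain ⟨hρm, hperp⟩ := hρ
  have horth := hperp h (mem_tangentSpace_self hh)
  have hhU : toL2 n h = U - ρ := by rw [hu, add_sub_cancel_right]
  have hhm : MemHs n s (toL2 n h) := hhU ▸ hUm.sub hρm
  -- Orthogonality of h and ρ gives a[h] = a[h,u], and next a[u] = a[h,u] + a[ρ].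
  have e1 : quad n s (toL2 n h) = bilin n s (toL2 n h) U := by
    rw [hu, bilin_add_right hn hs hhm hhm hρm, bilin_self, bilin_comm (g := ρ), horth, add_zero]
  have e2 : quad n s U = bilin n s (toL2 n h) U + quad n s ρ := by
    rw [← e1, ← bilin_self, ← bilin_self, ← bilin_self]
    nth_rewrite 2 [hu]
    rw [bilin_add_right hn hs hUm hhm hρm, bilin_comm (f := U), ← e1, bilin_self,
      bilin_comm (f := U), hu, bilin_add_right hn hs hρm hhm hρm, horth, zero_add]
  have e3 := alpha_mul_norm_proj_le_quad hn hs hhm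
  obtain ⟨c, ζ, hc, hζ, hω⟩ := hh
  set γ := s - (n : ℝ) / 2 with hγ
  have hexp : (2 * s - n) / 2 = γ := by rw [hγ]; ring
  rw [hexp] at hω
  set h' : C(Sph n, ℝ) := c⁻¹ • h with hh'
  have hω' : ∀ ω : Sph n, h' ω = (1 - inner ℝ ζ ω.1) ^ γ := fun ω => by
    simp [hh', hω ω, hc.ne']
  have hhc : ∀ ω, h ω = c * h' ω := fun ω => by simp [hh', hc.ne']
  obtain ⟨bI, bH, bH', bL, bΦ⟩ := integral_optimizer_bounds hs.1 hs.2 hij hjk hki hζ hω'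
  have hP0 := norm_proj_zero_sq_mul_le (toL2 n h)
  have hP1 := inner_sq_le_norm_proj_sq_mul (linearForm_mem_solidHarmonics ζ) (toL2 n h)
  rw [quad_testFunction hij hjk hki] at e2
  have e4 := bilin_testFunction (s := s) (δ := δ) hij hjk hki (toL2 n h)
  rw [inner_toL2, inner_toL2] at e4
  rw [inner_toL2, norm_toL2_sq] at hP1
  rw [inner_toL2] at hP0
  simp only [restrictSphere_linearForm, restrictSphere_one, ContinuousMap.one_apply, mul_one, hhc,
    mul_assoc, integral_const_mul] at e4 hP0 hP1
  set I := ∫ ω : Sph n, (inner ℝ ζ ω.1) ^ 2 ∂(surf n)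
  set H := ∫ ω, h' ω ∂(surf n)
  set L := ∫ ω, h' ω * inner ℝ ζ ω.1 ∂(surf n)
  set Φ := ∫ ω, h' ω * restrictSphere n (pairSum i j k) ω ∂(surf n)
  set V := (surf n).real univ
  set p0 := ‖proj n 0 (toL2 n h)‖ ^ 2
  set p1 := ‖proj n 1 (toL2 n h)‖ ^ 2
  set a0 := alpha n s 0
  set a1 := alpha n s 1
  set a2 := alpha n s 2
  have hV : 0 < V := surf_real_univ_pos n
  have hI0 : 0 ≤ I := integral_nonneg fun ω => sq_nonneg _
  have ha0 : a0 < 0 := alpha_zero_neg hs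
  have ha1 : 0 < a1 := alpha_succ_pos hs 0
  have ha2 : 0 < a2 := alpha_succ_pos hs 1
  have hγ0 : 0 < γ := hs.1
  rw [e1, e4] at e3
  rw [e4] at e2
  have hfin := neg_mul_le_of_projection_bounds ha0 ha1.le ha2.le hγ0 hδ hc hV hI0 hδ1 hδ2
    (sq_nonneg _) hP0 hP1 bI bH bH' bL bΦ e3
  linarith

theorem le_stabDist_testFunction {n : ℕ} (hn : 2 ≤ n) {s : ℝ}
    (hs : s - (n : ℝ) / 2 ∈ Ioo (0 : ℝ) 1) {i j k : Fin (n + 1)} (hij : i ≠ j) (hjk : j ≠ k)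
    (hki : k ≠ i) {δ : ℝ} (hδ : 0 ≤ δ)
    (hδ1 : 3 * δ * alpha n s 2 < -alpha n s 0 * (s - n / 2))
    (hδ2 : 24 * δ * alpha n s 2 ≤ alpha n s 1 * (s - n / 2) ^ 2) :
    ((δ ^ 2 * alpha n s 2 * ∫ ω, restrictSphere n (pairSum i j k) ω ^ 2 ∂(surf n) : ℝ) : EReal) ≤
      stabDist n s (testFunction i j k δ) := by
  refine le_sInf ?_
  rintro r ⟨h, hh, ρ, hρ, hu, rfl⟩
  exact EReal.coe_le_coe_iff.mpr (le_quad_of_decomposition hn hs hij hjk hki hδ hδ1 hδ2 hh hρ hu)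

/-! ### The deficit of the test functions -/

/-- If `∫ φ³ > 0`, the third order term makes `‖1 - δ φ‖_q²`, `q < 0`, smaller than its second order
expansion for small `δ > 0`. -/
theorem eventually_rpow_integral_lt {n : ℕ} {q : ℝ} (hq : q ≤ -2) {φ : C(Sph n, ℝ)}
    (h1 : ∫ ω, φ ω ∂(surf n) = 0) (h3 : 0 < ∫ ω, φ ω ^ 3 ∂(surf n)) (hφ : ∀ ω, |φ ω| ≤ 3) :
    ∀ᶠ δ in nhdsWithin (0 : ℝ) (Ioi 0),
      (∫ ω, (1 - δ * φ ω) ^ q ∂(surf n)) ^ (2 / q) < (surf n).real univ ^ (2 / q) *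
        (1 - (1 - q) * δ ^ 2 * ((∫ ω, φ ω ^ 2 ∂(surf n)) / (surf n).real univ)) := by
  set V := (surf n).real univ with hVdef
  have hV : 0 < V := surf_real_univ_pos n
  set m2 := (∫ ω, φ ω ^ 2 ∂(surf n)) / V with hm2
  set m3 := (∫ ω, φ ω ^ 3 ∂(surf n)) / V with hm3
  have hm2' : 0 ≤ m2 := div_nonneg (integral_nonneg fun ω => sq_nonneg _) hV.le
  have hm3' : 0 < m3 := div_pos h3 hV
  -- Normalized Taylor coefficients of ∫(1 - δφ)^q. The sign in -δφ turns q - 2 into 2 - q, making C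
  -- positive.
  set B := q * (q - 1) / 2 * m2 with hB
  set C := q * (q - 1) * (2 - q) / 6 * m3 with hC
  have hqq : 0 < q * (q - 1) := mul_pos_of_neg_of_neg (by linarith) (by linarith)
  have hB0 : 0 ≤ B := by positivity
  have hC0 : 0 < C := mul_pos (div_pos (mul_pos hqq (by linarith)) (by norm_num)) hm3'
  have hK : 0 < (1 - q) * (2 - q) / 3 * m3 :=
    mul_pos (div_pos (mul_pos (by linarith) (by linarith)) (by norm_num)) hm3'
  -- Multiplied by δ³, this says that the cubic gain exceeds the error (1 - q)δ²m2·A made by the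
  -- denominator 1 + A.
  have ev1 : ∀ᶠ δ : ℝ in nhds 0, (1 - q) * m2 * (δ * (B + C * δ)) < (1 - q) * (2 - q) / 3 * m3 := by
    have : ContinuousAt (fun δ : ℝ => (1 - q) * m2 * (δ * (B + C * δ))) 0 := by fun_prop
    refine this.eventually_lt_const ?_
    simpa using hK
  have ev2 : ∀ᶠ δ : ℝ in nhds 0, 3 * δ < 1 := by
    have : ContinuousAt (fun δ : ℝ => 3 * δ) 0 := by fun_prop
    refine this.eventually_lt_const ?_
    simp
  filter_upwards [nhdsWithin_le_nhds ev1, nhdsWithin_le_nhds ev2, self_mem_nhdsWithin]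
    with δ hδ1 hδ2 hδ0
  have hδ : 0 < δ := hδ0
  have hlt : ∀ ω, -1 < -δ * φ ω := fun ω => by
    have := abs_le.mp (hφ ω)
    nlinarith
  set A := δ ^ 2 * (B + C * δ) with hA
  have hA0 : 0 ≤ A := by positivity
  have hlow : V * (1 + A) ≤ ∫ ω, (1 - δ * φ ω) ^ q ∂(surf n) := by
    have i1 := integrable_continuousMap φ
    have i2 : Integrable (fun ω => φ ω ^ 2) (surf n) := integrable_continuousMap (φ ^ 2)
    have i3 : Integrable (fun ω => φ ω ^ 3) (surf n) := integrable_continuousMap (φ ^ 3)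
    have i0 : Integrable (fun _ : Sph n => (1 : ℝ)) (surf n) := integrable_const _
    have iu : Integrable (fun ω => (1 - δ * φ ω) ^ q) (surf n) := by
      refine Continuous.integrable_of_hasCompactSupport ?_ (HasCompactSupport.of_compactSpace _)
      refine Continuous.rpow_const (by fun_prop) fun ω => Or.inl ?_
      have := hlt ω
      linarith
    have ip := ((i0.sub (i1.const_mul (q * δ))).add (i2.const_mul (q * (q - 1) / 2 * δ ^ 2))).add
      (i3.const_mul (q * (q - 1) * (2 - q) / 6 * δ ^ 3))
    have hmono := integral_mono ip iu fun ω => by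
      have := cubic_le_rpow (q := q) (by linarith) (hlt ω)
      simp only [Pi.add_apply, Pi.sub_apply]
      rw [show 1 - δ * φ ω = 1 + -δ * φ ω by ring]
      refine le_trans (le_of_eq ?_) this
      ring
    refine le_trans (le_of_eq ?_) hmono
    rw [integral_add' ((i0.sub (i1.const_mul _)).add (i2.const_mul _)) (i3.const_mul _),
      integral_add' (i0.sub (i1.const_mul _)) (i2.const_mul _), integral_sub' i0 (i1.const_mul _),
      integral_const_mul, integral_const_mul, integral_const_mul, h1, hA, hB, hC, hm2, hm3]
    simp only [integral_const, smul_eq_mul, mul_one, ← hVdef]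
    field_simp
    ring
  have hq0 : q ≠ 0 := by linarith
  have hr1 : -1 ≤ 2 / q := by
    rw [le_div_iff_of_neg (by linarith)]
    linarith
  have hr2 : 2 / q ≤ 0 := div_nonpos_of_nonneg_of_nonpos (by norm_num) (by linarith)
  calc (∫ ω, (1 - δ * φ ω) ^ q ∂(surf n)) ^ (2 / q)
      ≤ (V * (1 + A)) ^ (2 / q) := Real.rpow_le_rpow_of_nonpos (by positivity) hlow hr2
    _ = V ^ (2 / q) * (1 + A) ^ (2 / q) := Real.mul_rpow hV.le (by linarith)
    _ ≤ V ^ (2 / q) * (1 + 2 / q * A / (1 + A)) :=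
      mul_le_mul_of_nonneg_left (one_add_rpow_le hA0 hr1 hr2) (Real.rpow_nonneg hV.le _)
    _ < V ^ (2 / q) * (1 - (1 - q) * δ ^ 2 * m2) := by
      refine mul_lt_mul_of_pos_left ?_ (Real.rpow_pos_of_pos hV _)
      have hrA : 2 / q * A = -(δ ^ 2 * ((1 - q) * m2 + (1 - q) * (2 - q) / 3 * m3 * δ)) := by
        rw [hA, hB, hC]
        field_simp
        ring
      have hlt' : 2 / q * A / (1 + A) < -((1 - q) * δ ^ 2 * m2) := by
        rw [div_lt_iff₀ (by linarith), hrA, hA]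
        have := mul_lt_mul_of_pos_left hδ1 (by positivity : 0 < δ ^ 3)
        linarith
      linarith

/-- An infinite distance is harmless: the quotient is then 0. -/
theorem coe_div_lt_coe_of_le {x κ D : ℝ} {d : EReal} (hκ : 0 < κ) (hD : 0 < D) (hd : (D : EReal) ≤ d)
    (hx : x < κ * D) : (x : EReal) / d < (κ : EReal) := by
  induction d with
  | bot => simp at hd
  | top => simpa using hκ
  | coe t =>
    have ht : D ≤ t := EReal.coe_le_coe_iff.mp hd
    rw [← EReal.coe_div, EReal.coe_lt_coe_iff, div_lt_iff₀ (hD.trans_le ht)]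
    exact hx.trans_le (mul_le_mul_of_nonneg_left ht hκ.le)

/-- The Sobolev constant is negative, so it reverses `hlt`. With q = 2n/(n - 2s) one has α(0)(1 - q)
= -α(1), which leaves the quadratic coefficient α(2) - α(1). -/
theorem testFunction_numerator_lt {n : ℕ} (hn : 2 ≤ n) {s : ℝ}
    (hs : s - (n : ℝ) / 2 ∈ Ioo (0 : ℝ) 1) {i j k : Fin (n + 1)} (hij : i ≠ j) (hjk : j ≠ k)
    (hki : k ≠ i) {δ : ℝ} (hδ : 0 ≤ δ) (hδ' : 3 * δ < 1)
    (hlt : (∫ ω, (1 - δ * restrictSphere n (pairSum i j k) ω) ^ (2 * n / (n - 2 * s)) ∂(surf n)) ^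
        (2 / (2 * n / (n - 2 * s))) < (surf n).real univ ^ (2 / (2 * n / (n - 2 * s))) *
        (1 - (1 - 2 * n / (n - 2 * s)) * δ ^ 2 *
          ((∫ ω, restrictSphere n (pairSum i j k) ω ^ 2 ∂(surf n)) / (surf n).real univ))) :
    quad n s (toL2 n (testFunction i j k δ)) -
        sobolevConst n s * powNorm n (2 * n / (n - 2 * s)) (testFunction i j k δ) ^ 2 <
      4 * s / (n + 2 * s + 2) *
        (δ ^ 2 * alpha n s 2 * ∫ ω, restrictSphere n (pairSum i j k) ω ^ 2 ∂(surf n)) := by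
  have hn0 : (0 : ℝ) < n := by
    have : (2 : ℝ) ≤ n := by exact_mod_cast hn
    linarith
  have hs1 := hs.1
  have hne : (n : ℝ) - 2 * s ≠ 0 := by linarith
  have hne' : (n : ℝ) + 2 * s + 2 ≠ 0 := by linarith
  have hexp : 2 / (2 * n / (n - 2 * s)) = ((n : ℝ) - 2 * s) / n := by field_simp
  have hpow : powNorm n (2 * n / (n - 2 * s)) (testFunction i j k δ) ^ 2 =
      (∫ ω, (1 - δ * restrictSphere n (pairSum i j k) ω) ^ (2 * n / (n - 2 * s)) ∂(surf n)) ^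
        (2 / (2 * n / (n - 2 * s))) := by
    rw [powNorm, ← Real.rpow_natCast, ← Real.rpow_mul (integral_nonneg fun ω =>
      Real.rpow_nonneg (testFunction_pos hδ hδ' ω).le _)]
    simp only [testFunction_apply]
    congr 1
    push_cast
    ring
  have hV := surf_real_univ_pos n
  have hS := sobolevConst_mul_rpow (by omega : 0 < n) s
  rw [hpow, quad_testFunction hij hjk hki]
  rw [hexp] at hlt ⊢
  have a01 := alpha_succ hs 0
  have a12 := alpha_succ hs 1
  have ha0 := alpha_zero_neg hs
  set X := (∫ ω, (1 - δ * restrictSphere n (pairSum i j k) ω) ^ (2 * n / (n - 2 * s)) ∂(surf n)) ^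
    (((n : ℝ) - 2 * s) / n)
  set M := ∫ ω, restrictSphere n (pairSum i j k) ω ^ 2 ∂(surf n)
  set V := (surf n).real univ
  have hVr : 0 < V ^ (((n : ℝ) - 2 * s) / n) := Real.rpow_pos_of_pos hV _
  have hSneg : sobolevConst n s < 0 := by
    by_contra! h
    have h1 := mul_nonneg h hVr.le
    rw [hS] at h1
    exact absurd (mul_neg_of_neg_of_pos ha0 hV) h1.not_gt
  have h1 := mul_lt_mul_of_neg_left hlt hSneg
  rw [← mul_assoc, hS] at h1
  simp only [Nat.cast_zero, zero_add, Nat.cast_one, Nat.reduceAdd] at a01 a12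
  have hq : alpha n s 0 * (1 - 2 * n / (n - 2 * s)) = -alpha n s 1 := by
    field_simp
    linear_combination 2 * a01
  have hκ : 4 * s / (n + 2 * s + 2) * alpha n s 2 = alpha n s 2 - alpha n s 1 := by
    rw [div_mul_eq_mul_div, div_eq_iff hne']
    linear_combination (-2) * a12
  have h2 : alpha n s 0 * V * (1 - (1 - 2 * n / (n - 2 * s)) * δ ^ 2 * (M / V)) =
      alpha n s 0 * V + alpha n s 1 * δ ^ 2 * M := by
    have : alpha n s 0 * V * (1 - (1 - 2 * n / (n - 2 * s)) * δ ^ 2 * (M / V)) =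
        alpha n s 0 * V - alpha n s 0 * (1 - 2 * n / (n - 2 * s)) * δ ^ 2 * (V * (M / V)) := by ring
    rw [this, hq, mul_div_cancel₀ M hV.ne']
    ring
  rw [h2] at h1
  have h3 : 4 * s / (n + 2 * s + 2) * (δ ^ 2 * alpha n s 2 * M) =
      (alpha n s 2 - alpha n s 1) * δ ^ 2 * M := by
    rw [← hκ]
    ring
  rw [h3]
  linarith

end ReverseSobolev

/-! ### Choice of δ and conclusion -/

theorem theorem2 (n : ℕ) (hn : 2 ≤ n) (s : ℝ) (hs : s - (n : ℝ) / 2 ∈ Set.Ioo (0 : ℝ) 1) :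
    ReverseSobolev.cBE n s < ((4 * s / ((n : ℝ) + 2 * s + 2) : ℝ) : EReal) := by
  open ReverseSobolev in
  have h2 : (2 : ℝ) ≤ n := by exact_mod_cast hn
  -- Three distinct coordinates exist because n ≥ 2.
  obtain ⟨i, j, k, hij, hjk, hki⟩ : ∃ i j k : Fin (n + 1), i ≠ j ∧ j ≠ k ∧ k ≠ i :=
    ⟨⟨0, by omega⟩, ⟨1, by omega⟩, ⟨2, by omega⟩, by simp, by simp, by simp⟩
  -- Here -2 < n - 2s < 0 and n ≥ 2. The bound puts 2/q in [-1, 0], the range of `one_add_rpow_le`.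
  have hq : 2 * (n : ℝ) / (n - 2 * s) ≤ -2 := by
    rw [div_le_iff_of_neg (by linarith [hs.1])]
    linarith [hs.2]
  have ha0 := alpha_zero_neg hs
  have ha1 : 0 < alpha n s 1 := alpha_succ_pos hs 0
  have ha2 : 0 < alpha n s 2 := alpha_succ_pos hs 1
  have ev : ∀ a b : ℝ, 0 < b → ∀ᶠ δ in nhdsWithin (0 : ℝ) (Set.Ioi 0), a * δ < b := fun a b hb => by
    have : ContinuousAt (fun δ : ℝ => a * δ) 0 := by fun_prop
    exact nhdsWithin_le_nhds (this.eventually_lt_const (by simpa using hb))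
  obtain ⟨δ, hlt, hδ1, hδ2, hδ3, hδ0⟩ :=
    ((eventually_rpow_integral_lt hq (integral_pairSum hij hjk hki)
      (integral_pairSum_cube_pos hij hjk hki) abs_restrictSphere_pairSum_le).and <|
      (ev 3 1 one_pos).and <|
      (ev (3 * alpha n s 2) _ (mul_pos (neg_pos.mpr ha0) hs.1)).and <|
      (ev (24 * alpha n s 2) _ (mul_pos ha1 (pow_pos hs.1 2))).and self_mem_nhdsWithin).exists
  have hδ : 0 < δ := hδ0
  refine sInf_lt_iff.mpr ⟨_, Set.mem_image_of_mem _ ⟨memHs_testFunction hij hjk hki,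
    testFunction_pos hδ.le hδ1, testFunction_notMem_optimizers hs hij hjk hki hδ.ne'⟩,
    coe_div_lt_coe_of_le (div_pos (by linarith [hs.1]) (by linarith [hs.1]))
      (mul_pos (mul_pos (pow_pos hδ 2) ha2) (integral_pairSum_sq_pos hij hjk hki))
      (le_stabDist_testFunction hn hs hij hjk hki hδ.le (by linarith) (by linarith))
      (testFunction_numerator_lt hn hs hij hjk hki hδ.le hδ1 hlt)⟩
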